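/- Let $p_1,\dots,p_N\ge 0$ with $p_1+\dots+p_N=1$, let $Q(z)=\sum_{j=1}^N p_jz^j$, and for $\eta\in L^1_{\mathrm{loc}}([1,\infty),\mathbb R)$, extended by zero to $\mathbb R$, let $\mathbb Q[\eta]=\sum_{j=1}^N p_j\,\eta^{*j}$, where $\eta^{*j}=\eta*\dots*\eta$ ($j$ factors). Let $$\mathbb P=\Bigl\{\eta\in L^1((1,\infty)) : \eta\ge 0 \text{ a.e.},\ \int_1^\infty\eta(y)\,dy=1\Bigr\}.$$ Let $(T_1\eta)(y)=\eta(y-1)$ for $y\ge2$ and $0$ for $y<2$, and $(S_\tau\eta)(y)=e^\tau\eta(e^\tau y)$ for $y\ge1$ and $0$ for $y<1$. Consider the equation $$\partial_\tau\eta=\partial_y(y\eta)+\beta(\tau)\,T_1\mathbb Q[\eta(\tau)],\qquad y\ge1,\ \tau\ge 0. \tag{1}$$ For $\eta_0\in\mathbb P$, its global solution with initial value $\eta_0$ is the unique $\eta\in C^0([0,\infty),L^1((1,\infty)))$ such that $$\eta(\tau)=S_\tau\eta_0+\int_0^\tau\beta(s)\,S_{\tau-s}T_1\mathbb Q[\eta(s)]\,ds\qquad(\tau\ge0),$$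 where the trace $\beta\in L^1_{\mathrm{loc}}([0,\infty))$ satisfies, for every $\tau_0\ge0$, $\beta(\tau)=e^{\tau-\tau_0}\eta(\tau_0,e^{\tau-\tau_0})$ for a.e. $\tau\in[\tau_0,\tau_0+\log2]$. We call $\eta_0$ a steady state of (1) if this solution satisfies $\eta(\tau)=\eta_0$ for all $\tau\ge0$. If $\eta_0$ agrees a.e. on $[1,2]$ with a continuous function $g$ (as every steady state does), we write $\eta_0(1)$ for $g(1)$. Let $\phi$ be the analytic function on the open unit disk with $\phi'(z)=1/(1-Q(z))$ and $\phi(0)=0$. For $\rho\in\mathbb P$, let $\mathcal N(\rho)$ be the (a.e. unique) function $w\in L^1_{\mathrm{loc}}([1,\infty),\mathbb R)$, extended by zero to $(-\infty,1)$, such that for every $\xi\in\mathbb C$ with $\operatorname{Im}\xi<0$ the function $x\mapsto e^{-i\xi x}w(x)$ is integrable and $$\int_1^\infty e^{-i\xi x}w(x)\,dx=\phi\Bigl(\int_1^\infty e^{-i\xi x}\rho(x)\,dx\Bigr);$$ that is, $\mathcal N=\mathcal F^{-1}\circ\phi\circ\mathcal F$. Let $w^*(y)=1/y$ for $y\ge1$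 and $w^*(y)=0$ for $y<1$. **Proposition.** Let $\eta_0\in\mathbb P$ and $\beta>0$. The following assertions are equivalent: a) $\eta_0$ is a steady state of (1) with $\eta_0(1)=\beta$; b) $\eta_0$ coincides almost everywhere on $(1,\infty)$ with the solution $\eta:[1,\infty)\to\mathbb R$ of $$(y\eta)'(y)+\beta\,(T_1\mathbb Q[\eta])(y)=0\quad(y\ge1),\qquad\eta(1)=\beta,$$ meaning that $y\mapsto y\eta(y)$ is absolutely continuous on bounded intervals and that the equation holds for almost every $y>1$; c) $\mathcal N(\eta_0)=\beta w^*$ almost everywhere. -/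

import Mathlib

open MeasureTheory Set
open scoped Convolution Interval

noncomputable section

namespace Coarsening

/-! ### Function-level operations -/

/-- The polynomial `Q(z) = ∑_{j=1}^N p_j z^j`, evaluated at complex arguments. -/
def Qpoly (N : ℕ) (p : ℕ → ℝ) (z : ℂ) : ℂ :=
  ∑ j ∈ Finset.Icc 1 N, (p j : ℂ) * z ^ j

/-- `convPow f k` is the convolution product of `k + 1` factors `f`, on the whole real line. -/
def convPow (f : ℝ → ℝ) : ℕ → ℝ → ℝ
  | 0 => f
  | k + 1 => f ⋆[ContinuousLinearMap.mul ℝ ℝ, volume] convPow f k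

/-- `ℚ[f] = ∑_{j=1}^N p_j f^{*j}`. -/
def nonlin (N : ℕ) (p : ℕ → ℝ) (f : ℝ → ℝ) (x : ℝ) : ℝ :=
  ∑ j ∈ Finset.Icc 1 N, p j * convPow f (j - 1) x

/-- The shift `(T₁ f)(y) = f (y - 1)` for `y ≥ 2`, and `0` for `y < 2`. -/
def shift (f : ℝ → ℝ) : ℝ → ℝ :=
  (Ici (2 : ℝ)).indicator fun y => f (y - 1)

/-- The rescaling `(S_τ f)(y) = e^τ f (e^τ y)` for `y ≥ 1`, and `0` for `y < 1`. -/
def rescale (τ : ℝ) (f : ℝ → ℝ) : ℝ → ℝ :=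
  (Ici (1 : ℝ)).indicator fun y => Real.exp τ * f (Real.exp τ * y)

theorem integrable_convPow {f : ℝ → ℝ} (hf : Integrable f) (k : ℕ) :
    Integrable (convPow f k) := by
  induction k with
  | zero => exact hf
  | succ k ih => exact hf.integrable_convolution _ ih

theorem integrable_nonlin (N : ℕ) (p : ℕ → ℝ) {f : ℝ → ℝ} (hf : Integrable f) :
    Integrable (nonlin N p f) :=
  integrable_finsetSum _ fun j _ => (integrable_convPow hf (j - 1)).const_mul (p j)

theorem integrable_shift {f : ℝ → ℝ} (hf : Integrable f) : Integrable (shift f) :=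
  (hf.comp_sub_right 1).indicator measurableSet_Ici

theorem integrable_rescale (τ : ℝ) {f : ℝ → ℝ} (hf : Integrable f) :
    Integrable (rescale τ f) :=
  ((hf.comp_mul_left' (Real.exp_pos τ).ne').const_mul (Real.exp τ)).indicator measurableSet_Ici

/-! ### The same operations on `L¹(ℝ)` -/

/-- The Banach space `L¹(ℝ)`. Elements of `L¹((1,∞))` are identified with their extensions by
zero, that is, with the elements of `L¹(ℝ)` satisfying `SupportedFromOne`. -/
abbrev L1 : Type := ℝ →₁[volume] ℝ

/-- Vanishing almost everywhere on `(-∞, 1)`. -/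
def SupportedFromOne (f : L1) : Prop := ∀ᵐ y : ℝ, y < 1 → f y = 0

/-- The set of probability densities on `(1,∞)`. -/
def probDensities : Set L1 :=
  {f | SupportedFromOne f ∧ (∀ᵐ y : ℝ, 0 ≤ f y) ∧ ∫ y in Ioi (1 : ℝ), f y = 1}

/-- `ℚ` as a map of `L¹`. -/
def nonlinL1 (N : ℕ) (p : ℕ → ℝ) (f : L1) : L1 :=
  (integrable_nonlin N p (L1.integrable_coeFn f)).toL1 _

/-- `T₁` as a map of `L¹`. -/
def shiftL1 (f : L1) : L1 :=
  (integrable_shift (L1.integrable_coeFn f)).toL1 _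

/-- `S_τ` as a map of `L¹`. -/
def rescaleL1 (τ : ℝ) (f : L1) : L1 :=
  (integrable_rescale τ (L1.integrable_coeFn f)).toL1 _

/-! ### The evolution equation and its steady states -/

/-- `η ∈ C⁰([0,∞), L¹((1,∞)))` is a global (mild) solution, with initial value `η₀`, of
`∂_τ η = ∂_y (y η) + β(τ) T₁ℚ[η]`: the integral equation
`η(τ) = S_τ η₀ + ∫_0^τ β(s) S_{τ-s} T₁ ℚ[η(s)] ds` (a Bochner integral in `L¹`) holds, where
`β ∈ L¹_loc([0,∞))` is the trace of `η` at `y = 1`, given by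
`β(τ) = e^{τ-τ₀} η(τ₀, e^{τ-τ₀})` for all `τ₀ ≥ 0` and almost all `τ` with
`0 ≤ τ - τ₀ ≤ log 2`. Only the values `η τ` with `τ ≥ 0` matter. -/
def IsGlobalSolution (N : ℕ) (p : ℕ → ℝ) (η₀ : L1) (η : ℝ → L1) : Prop :=
  ContinuousOn η (Ici 0) ∧
  (∀ τ, 0 ≤ τ → SupportedFromOne (η τ)) ∧
  ∃ β : ℝ → ℝ,
    LocallyIntegrableOn β (Ici 0) ∧
    (∀ τ₀, 0 ≤ τ₀ → ∀ᵐ τ : ℝ, τ ∈ Icc τ₀ (τ₀ + Real.log 2) →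
      β τ = Real.exp (τ - τ₀) * η τ₀ (Real.exp (τ - τ₀))) ∧
    ∀ τ, 0 ≤ τ →
      η τ = rescaleL1 τ η₀
        + ∫ s in (0 : ℝ)..τ, β s • rescaleL1 (τ - s) (shiftL1 (nonlinL1 N p (η s)))

/-- `η₀` is a steady state: the (existing and unique) global solution with initial value `η₀`
is constant in time. -/
def IsSteadyState (N : ℕ) (p : ℕ → ℝ) (η₀ : L1) : Prop :=
  (∃ η : ℝ → L1, IsGlobalSolution N p η₀ η) ∧
  ∀ η : ℝ → L1, IsGlobalSolution N p η₀ η → ∀ τ, 0 ≤ τ → η τ = η₀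

/-- `η₀(1) = β` for an integrable function `η₀` that agrees almost everywhere on `[1,2]` with a
continuous function: the value at `1` is that of the continuous representative. -/
def HasValueAtOne (η₀ : L1) (β : ℝ) : Prop :=
  ∃ g : ℝ → ℝ, ContinuousOn g (Icc 1 2) ∧ g 1 = β ∧ ∀ᵐ y : ℝ, y ∈ Icc (1 : ℝ) 2 → η₀ y = g y

/-! ### The steady-state differential equation -/

/-- `η : [1,∞) → ℝ` (values at `y < 1` are irrelevant) solves
`(y η)'(y) + β (T₁ ℚ[η])(y) = 0` for `y ≥ 1`, with `η(1) = β`: the function `y η(y)` is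
absolutely continuous on bounded intervals and the equation holds almost everywhere.
In `ℚ[η]` the function `η` is extended by zero to `(-∞, 1)`. -/
structure SolvesSteadyODE (N : ℕ) (p : ℕ → ℝ) (β : ℝ) (η : ℝ → ℝ) : Prop where
  initial : η 1 = β
  absCont : ∀ R : ℝ, 1 < R → AbsolutelyContinuousOnInterval (fun y => y * η y) 1 R
  ode : ∀ᵐ y : ℝ, 1 < y →
    HasDerivAt (fun z => z * η z) (-(β * shift (nonlin N p ((Ici (1 : ℝ)).indicator η)) y)) y

/-! ### The nonlinear transformation `𝒩 = ℱ⁻¹ ∘ φ ∘ ℱ` -/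

/-- The primitive of `1 / (1 - Q)` in the open unit disk that vanishes at `0`, as the integral
along the segment `[0, z]`. -/
def phi (N : ℕ) (p : ℕ → ℝ) (z : ℂ) : ℂ :=
  ∫ t in (0 : ℝ)..1, z / (1 - Qpoly N p ((t : ℂ) * z))

/-- The Fourier(-Laplace) transform `∫_1^∞ e^{-iξx} f(x) dx`, for `Im ξ ≤ 0`. -/
def fourierLaplace (f : ℝ → ℝ) (ξ : ℂ) : ℂ :=
  ∫ x in Ioi (1 : ℝ), Complex.exp (-(Complex.I * ξ * (x : ℂ))) * (f x : ℂ)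

/-- `w = ℱ⁻¹(φ(ℱ ρ))`: `w` is a locally integrable function on `[1,∞)`, extended by zero, whose
Fourier-Laplace transform is `φ(ρ̂(ξ))` in the open lower half-plane. Such a `w` is unique up to
equality almost everywhere. -/
structure IsTransformOf (N : ℕ) (p : ℕ → ℝ) (ρ w : ℝ → ℝ) : Prop where
  locallyIntegrable : LocallyIntegrableOn w (Ici 1)
  eq_zero : ∀ x < 1, w x = 0
  integrable : ∀ ξ : ℂ, ξ.im < 0 →
    IntegrableOn (fun x : ℝ => Complex.exp (-(Complex.I * ξ * (x : ℂ))) * (w x : ℂ)) (Ioi 1)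
  transform_eq : ∀ ξ : ℂ, ξ.im < 0 → fourierLaplace w ξ = phi N p (fourierLaplace ρ ξ)

open Classical in
/-- The map `𝒩 = ℱ⁻¹ ∘ φ ∘ ℱ` (with value `0` where the inverse transform does not exist, which
does not happen for probability densities on `(1,∞)`). -/
def calN (N : ℕ) (p : ℕ → ℝ) (ρ : ℝ → ℝ) : ℝ → ℝ :=
  if h : ∃ w, IsTransformOf N p ρ w then h.choose else 0

/-- `w*(y) = 1/y` for `y ≥ 1`, and `0` for `y < 1`. -/
def wStar : ℝ → ℝ := (Ici (1 : ℝ)).indicator fun y => 1 / y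

end Coarsening

end

/-!
All three assertions are equivalent to the integrated equation
`y η₀(y) = β ∫_y^∞ T₁ℚ[η₀]` for almost every `y > 1`.

For (b) this is integration from `1` to `y`, since `T₁ℚ[η₀]` is again a probability density.

For (c), let `L` be the Laplace transform. As `φ' = 1 / (1 - Q)` and `L(T₁ℚ[η₀]) = e^{-s} Q(L η₀)`,
the derivative of `φ(L η₀) - β L w*` on `Re s > 0` is, up to the nonvanishing factor
`1 / (1 - Q(L η₀))`, the negative of the Laplace transform of the defect
`y η₀(y) - β ∫_y^∞ T₁ℚ[η₀]`. Both `φ(L η₀)` and `L w*` tend to `0` at `+∞`, so they agree up to the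
factor `β` if and only if the defect vanishes.

For (a), the integrals over `(a, ∞)` of the two sides of the Duhamel formula for the constant
function `η₀` with constant trace `β` agree for all `a` and `τ` if and only if the integrated
equation holds. A stationary solution has constant trace because the same function describes its
trace on every interval of length `log 2`. Conversely, any solution starting at `η₀` stays there:
its state at time `n log 2` determines its trace on the next interval of length `log 2`, where
Grönwall's lemma applies since `ℚ` is locally Lipschitz on `L¹`.
-/

namespace Coarsening

open Filter Topology FourierTransform

variable {N : ℕ} {p : ℕ → ℝ} {f g : ℝ → ℝ} {s : ℂ}

/-! ### Convolution powers and exponential twists -/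

theorem convPow_congr (h : f =ᵐ[volume] g) (k : ℕ) : convPow f k =ᵐ[volume] convPow g k := by
  induction k with
  | zero => exact h
  | succ k ih => exact .of_eq (convolution_congr _ h ih)

theorem nonlin_congr (N : ℕ) (p : ℕ → ℝ) (h : f =ᵐ[volume] g) :
    nonlin N p f =ᵐ[volume] nonlin N p g := by
  filter_upwards [ae_all_iff.2 (convPow_congr h)] with x hx
  simp only [nonlin, hx]

theorem shift_congr (h : f =ᵐ[volume] g) : shift f =ᵐ[volume] shift g :=
  ((measurePreserving_sub_right volume (1 : ℝ)).quasiMeasurePreserving.ae_eq_comp h).indicator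

theorem convPow_ae_eq_zero (hf : ∀ᵐ y : ℝ, y < 1 → f y = 0) (k : ℕ) :
    ∀ᵐ y : ℝ, y < 1 → convPow f k y = 0 := by
  induction k with
  | zero => exact hf
  | succ k ih =>
    refine .of_forall fun x hx => integral_eq_zero_of_ae ?_
    filter_upwards [hf, (quasiMeasurePreserving_sub_left_of_right_invariant volume x).tendsto_ae ih]
      with t hft hkt
    rcases lt_or_ge t 1 with ht | ht
    · simp [hft ht]
    · simp [hkt (by linarith)]

theorem nonlin_ae_eq_zero (N : ℕ) (p : ℕ → ℝ) (hf : ∀ᵐ y : ℝ, y < 1 → f y = 0) :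
    ∀ᵐ y : ℝ, y < 1 → nonlin N p f y = 0 := by
  filter_upwards [ae_all_iff.2 (convPow_ae_eq_zero hf)] with x hx hx1
  simp [nonlin, hx _ hx1]

theorem shift_ae_eq (hf : ∀ᵐ y : ℝ, y < 1 → f y = 0) :
    shift f =ᵐ[volume] fun y => f (y - 1) := by
  filter_upwards [(measurePreserving_sub_right volume (1 : ℝ)).quasiMeasurePreserving.tendsto_ae hf]
    with x hx
  by_cases h : 2 ≤ x
  · simp [shift, h]
  · simp [shift, h, hx (by linarith)]

/-- The function `x ↦ e^{-sx} f(x)`, whose integral is the Laplace transform of `f` at `s`. -/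
noncomputable def twist (s : ℂ) (f : ℝ → ℝ) (x : ℝ) : ℂ := Complex.exp (-(s * x)) * f x

theorem twist_zero (f : ℝ → ℝ) : twist 0 f = fun x => (f x : ℂ) := by
  ext x; simp [twist]

theorem norm_twist (s : ℂ) (f : ℝ → ℝ) (x : ℝ) :
    ‖twist s f x‖ = Real.exp (-(s.re * x)) * |f x| := by
  simp [twist, Complex.norm_exp]

theorem twist_id_mul (s : ℂ) (f : ℝ → ℝ) (x : ℝ) :
    twist s (fun x => x * f x) x = x * twist s f x := by
  simp only [twist]; push_cast; ring

theorem twist_sub (s : ℂ) (f g : ℝ → ℝ) :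
    (twist s fun x => f x - g x) = fun x => twist s f x - twist s g x := by
  ext x; simp [twist, mul_sub]

theorem twist_const_mul (s : ℂ) (c : ℝ) (f : ℝ → ℝ) :
    (twist s fun x => c * f x) = fun x => c * twist s f x := by
  ext x; simp only [twist]; push_cast; ring

theorem twist_convolution (s : ℂ) (f g : ℝ → ℝ) :
    twist s (f ⋆[ContinuousLinearMap.mul ℝ ℝ, volume] g) =
      twist s f ⋆[ContinuousLinearMap.mul ℂ ℂ, volume] twist s g := by
  ext x
  change Complex.exp (-(s * x)) * ((∫ t, f t * g (x - t) : ℝ) : ℂ) =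
    ∫ t, twist s f t * twist s g (x - t)
  rw [← integral_complex_ofReal, ← integral_const_mul]
  congr 1 with t
  have hexp : Complex.exp (-(s * x)) =
      Complex.exp (-(s * t)) * Complex.exp (-(s * ((x - t : ℝ) : ℂ))) := by
    rw [← Complex.exp_add]; congr 1; push_cast; ring
  simp only [twist, hexp]
  push_cast
  ring

theorem integrable_twist_convPow (hf : Integrable (twist s f)) (k : ℕ) :
    Integrable (twist s (convPow f k)) := by
  induction k with
  | zero => exact hf
  | succ k ih =>
    rw [convPow, twist_convolution]
    exact hf.integrable_convolution _ ih

theorem integral_twist_convPow (hf : Integrable (twist s f)) (k : ℕ) :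
    ∫ x, twist s (convPow f k) x = (∫ x, twist s f x) ^ (k + 1) := by
  induction k with
  | zero => simp [convPow]
  | succ k ih =>
    rw [convPow, twist_convolution, integral_convolution _ hf (integrable_twist_convPow hf k), ih]
    simp [pow_succ']

theorem integral_twist_nonlin (N : ℕ) (p : ℕ → ℝ) (hf : Integrable (twist s f)) :
    ∫ x, twist s (nonlin N p f) x = Qpoly N p (∫ x, twist s f x) := by
  have htwist : twist s (nonlin N p f) =
      fun x => ∑ j ∈ Finset.Icc 1 N, (p j : ℂ) * twist s (convPow f (j - 1)) x := by
    ext x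
    simp only [twist, nonlin, Complex.ofReal_sum, Complex.ofReal_mul, Finset.mul_sum,
      mul_left_comm]
  rw [htwist, integral_finsetSum _ fun j _ => (integrable_twist_convPow hf (j - 1)).const_mul _]
  refine Finset.sum_congr rfl fun j hj => ?_
  rw [integral_const_mul, integral_twist_convPow hf, Nat.sub_add_cancel (Finset.mem_Icc.1 hj).1]

theorem integral_twist_shift (hf : ∀ᵐ y : ℝ, y < 1 → f y = 0) :
    ∫ x, twist s (shift f) x = Complex.exp (-s) * ∫ x, twist s f x := by
  have htwist : twist s (shift f) =ᵐ[volume] fun x => Complex.exp (-s) * twist s f (x - 1) := by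
    filter_upwards [shift_ae_eq hf] with x hx
    simp only [twist, hx, ← mul_assoc, ← Complex.exp_add]
    congr 2
    push_cast
    ring
  rw [integral_congr_ae htwist, integral_const_mul, integral_sub_right_eq_self (twist s f)]

theorem integral_shift_nonlin (hp : ∑ j ∈ Finset.Icc 1 N, p j = 1) (hi : Integrable f)
    (hf : ∀ᵐ y : ℝ, y < 1 → f y = 0) (h1 : ∫ y, f y = 1) :
    ∫ y, shift (nonlin N p f) y = 1 := by
  have htwist : ∫ y, twist 0 (shift (nonlin N p f)) y = Qpoly N p (∫ y, twist 0 f y) := by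
    rw [integral_twist_shift (nonlin_ae_eq_zero N p hf),
      integral_twist_nonlin N p (by rw [twist_zero]; exact hi.ofReal)]
    simp
  have hQ : Qpoly N p 1 = 1 := by simp [Qpoly, ← Complex.ofReal_sum, hp]
  simp only [twist_zero, integral_complex_ofReal, h1, Complex.ofReal_one, hQ] at htwist
  exact_mod_cast htwist

theorem setIntegral_Ioi_one_eq_integral {E : Type*} [NormedAddCommGroup E] [NormedSpace ℝ E]
    {f : ℝ → E} (hf : ∀ᵐ y : ℝ, y < 1 → f y = 0) : ∫ y in Ioi (1 : ℝ), f y = ∫ y, f y := by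
  rw [← integral_Ici_eq_integral_Ioi]
  refine setIntegral_eq_integral_of_ae_compl_eq_zero ?_
  filter_upwards [hf] with x hx hx1
  exact hx (not_le.1 hx1)

/-! ### Tail integrals -/

/-- The tail `x ↦ ∫_x^∞ h`. -/
noncomputable def tail (h : ℝ → ℝ) (x : ℝ) : ℝ := ∫ y in Ioi x, h y

theorem tail_congr (h : f =ᵐ[volume] g) : tail f = tail g :=
  funext fun _ => integral_congr_ae (ae_restrict_of_ae h)

theorem tail_sub_tail (hf : Integrable f) (a b : ℝ) : tail f a - tail f b = ∫ x in a..b, f x :=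
  intervalIntegral.integral_Ioi_sub_Ioi' hf.integrableOn hf.integrableOn

theorem continuous_tail (hf : Integrable f) : Continuous (tail f) := by
  have hprim : tail f = fun x => tail f 0 - ∫ y in (0 : ℝ)..x, f y := by
    ext x; rw [← tail_sub_tail hf, sub_sub_cancel]
  rw [hprim]
  exact continuous_const.sub (hf.continuous_primitive 0)

theorem abs_tail_le (hf : Integrable f) (x : ℝ) : |tail f x| ≤ ∫ y, |f y| :=
  (norm_integral_le_integral_norm _).trans
    (setIntegral_le_integral hf.norm (.of_forall fun _ => norm_nonneg _))

theorem absolutelyContinuousOnInterval_tail (hf : Integrable f) (a b : ℝ) :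
    AbsolutelyContinuousOnInterval (tail f) a b := by
  have hprim : tail f = (fun _ => tail f a) - fun x => ∫ y in a..x, f y := by
    ext x; rw [Pi.sub_apply, ← tail_sub_tail hf, sub_sub_cancel]
  rw [hprim]
  exact (LipschitzWith.const (tail f a)).lipschitzOnWith.absolutelyContinuousOnInterval.sub
    (hf.intervalIntegrable.absolutelyContinuousOnInterval_intervalIntegral left_mem_uIcc)

theorem ae_hasDerivAt_tail (hf : Integrable f) : ∀ᵐ x : ℝ, HasDerivAt (tail f) (-f x) x := by
  have hprim : tail f = fun x => tail f 0 - ∫ y in (0 : ℝ)..x, f y := by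
    ext x; rw [← tail_sub_tail hf, sub_sub_cancel]
  filter_upwards [LocallyIntegrable.ae_hasDerivAt_integral hf.locallyIntegrable] with x hx
  rw [hprim]
  exact (hx 0).const_sub _

theorem absolutelyContinuousOnInterval_congr {X : Type*} [PseudoMetricSpace X] {f g : ℝ → X}
    {a b : ℝ} (hf : AbsolutelyContinuousOnInterval f a b) (hfg : EqOn f g (uIcc a b)) :
    AbsolutelyContinuousOnInterval g a b := by
  refine Tendsto.congr' ?_ hf
  filter_upwards [mem_inf_of_right (mem_principal_self _)] with E hE
  refine Finset.sum_congr rfl fun i hi => ?_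
  rw [hfg (hE.1 i hi).1, hfg (hE.1 i hi).2]

/-! ### The Laplace transform -/

/-- The Laplace transform over `(1, ∞)`. At `s = iξ` it is `fourierLaplace`, the lower half-plane
`Im ξ < 0` becoming the right half-plane `Re s > 0`. -/
noncomputable def laplace (f : ℝ → ℝ) (s : ℂ) : ℂ := ∫ x in Ioi (1 : ℝ), twist s f x

/-- The integral `laplace f s` converges absolutely in the right half-plane `Re s > 0`. -/
def LaplaceIntegrable (f : ℝ → ℝ) : Prop :=
  ∀ s : ℂ, 0 < s.re → IntegrableOn (twist s f) (Ioi 1)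

theorem fourierLaplace_eq_laplace (f : ℝ → ℝ) (ξ : ℂ) :
    fourierLaplace f ξ = laplace f (Complex.I * ξ) := rfl

theorem laplace_congr (h : ∀ᵐ x : ℝ, 1 < x → f x = g x) (s : ℂ) : laplace f s = laplace g s := by
  refine setIntegral_congr_ae measurableSet_Ioi ?_
  filter_upwards [h] with x hx hx1
  rw [twist, twist, hx hx1]

theorem laplace_const_mul (c : ℝ) (f : ℝ → ℝ) (s : ℂ) :
    laplace (fun x => c * f x) s = c * laplace f s := by
  rw [laplace, twist_const_mul, integral_const_mul, laplace]

theorem laplace_sub (hf : IntegrableOn (twist s f) (Ioi 1))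
    (hg : IntegrableOn (twist s g) (Ioi 1)) :
    laplace (fun x => f x - g x) s = laplace f s - laplace g s := by
  rw [laplace, twist_sub, integral_sub hf hg, laplace, laplace]

theorem hasDerivAt_twist (s : ℂ) (f : ℝ → ℝ) (x : ℝ) :
    HasDerivAt (fun z => twist z f x) (-twist s (fun x => x * f x) x) s := by
  have hlin : HasDerivAt (fun z : ℂ => -(z * x)) (-(x : ℂ)) s := by
    simpa using ((hasDerivAt_id s).mul_const (x : ℂ)).fun_neg
  convert! hlin.cexp.mul_const (f x : ℂ) using 1
  rw [twist_id_mul, twist]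
  ring

theorem mul_exp_neg_le {c : ℝ} (hc : 0 < c) (x : ℝ) : x * Real.exp (-(c * x)) ≤ 1 / c := by
  rw [Real.exp_neg, ← div_eq_mul_inv, div_le_div_iff₀ (Real.exp_pos _) hc]
  nlinarith [Real.add_one_le_exp (c * x)]

theorem norm_twist_id_mul_le {c x : ℝ} (hc : 0 < c) (hs : 2 * c ≤ s.re) (hx : 0 ≤ x) :
    ‖twist s (fun x => x * f x) x‖ ≤ 1 / c * ‖twist c f x‖ := by
  rw [twist_id_mul, norm_mul, norm_twist, norm_twist, Complex.norm_real, Complex.ofReal_re,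
    Real.norm_of_nonneg hx, ← mul_assoc, ← mul_assoc]
  refine mul_le_mul_of_nonneg_right ?_ (abs_nonneg _)
  calc x * Real.exp (-(s.re * x))
      ≤ x * Real.exp (-(c * x) + -(c * x)) := by gcongr; nlinarith
    _ = x * Real.exp (-(c * x)) * Real.exp (-(c * x)) := by rw [Real.exp_add, mul_assoc]
    _ ≤ 1 / c * Real.exp (-(c * x)) := by gcongr; exact mul_exp_neg_le hc x

theorem LaplaceIntegrable.id_mul (hf : LaplaceIntegrable f) :
    LaplaceIntegrable fun x => x * f x := fun s hs => by
  have hc : 0 < s.re / 2 := half_pos hs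
  refine Integrable.mono' ((hf (s.re / 2 : ℝ) (by simpa using hs)).norm.const_mul (1 / (s.re / 2)))
    ?_ ?_
  · simp only [funext (twist_id_mul s f)]
    exact Complex.continuous_ofReal.aestronglyMeasurable.mul (hf s hs).aestronglyMeasurable
  · filter_upwards [ae_restrict_mem measurableSet_Ioi] with x hx
    exact norm_twist_id_mul_le hc (by linarith) (zero_le_one.trans (mem_Ioi.1 hx).le)

theorem LaplaceIntegrable.hasDerivAt (hf : LaplaceIntegrable f) (hs : 0 < s.re) :
    HasDerivAt (laplace f) (-laplace (fun x => x * f x) s) s := by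
  have hc : 0 < s.re / 4 := by positivity
  have hU : {z : ℂ | s.re / 2 < z.re} ∈ 𝓝 s :=
    (isOpen_lt continuous_const Complex.continuous_re).mem_nhds (half_lt_self hs)
  rw [laplace, ← integral_neg]
  refine (hasDerivAt_integral_of_dominated_loc_of_deriv_le (μ := volume.restrict (Ioi 1))
    (F := fun z x => twist z f x) (F' := fun z x => -twist z (fun x => x * f x) x)
    (bound := fun x => 1 / (s.re / 4) * ‖twist (s.re / 4 : ℝ) f x‖) hU ?_ (hf s hs)
    (hf.id_mul s hs).aestronglyMeasurable.neg ?_ ((hf _ (by simpa using hs)).norm.const_mul _)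
    (.of_forall fun x z _ => hasDerivAt_twist z f x)).2
  · filter_upwards [hU] with z hz
    exact (hf z (by linarith [mem_ofPred.1 hz])).aestronglyMeasurable
  · filter_upwards [ae_restrict_mem measurableSet_Ioi] with x hx z hz
    rw [norm_neg]
    exact norm_twist_id_mul_le hc (by linarith [mem_ofPred.1 hz])
      (zero_le_one.trans (mem_Ioi.1 hx).le)

theorem LaplaceIntegrable.tendsto_zero (hf : LaplaceIntegrable f) :
    Tendsto (fun t : ℝ => laplace f t) atTop (𝓝 0) := by
  refine squeeze_zero_norm'
    (a := fun t : ℝ => Real.exp (-(t - 1)) * ∫ x in Ioi (1 : ℝ), ‖twist 1 f x‖) ?_ ?_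
  · filter_upwards [eventually_ge_atTop 1] with t ht
    rw [laplace, ← integral_const_mul]
    refine norm_integral_le_of_norm_le ((hf 1 (by simp)).norm.const_mul _) ?_
    filter_upwards [ae_restrict_mem measurableSet_Ioi] with x hx
    rw [norm_twist, norm_twist, ← mul_assoc, ← Real.exp_add, Complex.ofReal_re, Complex.one_re]
    gcongr
    nlinarith [mem_Ioi.1 hx]
  · have hexp : Tendsto (fun t : ℝ => Real.exp (-(t - 1))) atTop (𝓝 0) :=
      Real.tendsto_exp_neg_atTop_nhds_zero.comp (tendsto_atTop_add_const_right _ (-1) tendsto_id)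
    simpa using hexp.mul_const (∫ x in Ioi (1 : ℝ), ‖twist 1 f x‖)

-- The Fourier transform is self-adjoint and every Schwartz function is a Fourier transform.
theorem ae_eq_zero_of_fourier_eq_zero {V E : Type*} [NormedAddCommGroup V] [InnerProductSpace ℝ V]
    [FiniteDimensional ℝ V] [MeasurableSpace V] [BorelSpace V] [NormedAddCommGroup E]
    [NormedSpace ℂ E] [CompleteSpace E] {f : V → E} (hf : Integrable f) (h : 𝓕 f = 0) :
    f =ᵐ[volume] 0 := by
  refine ae_eq_zero_of_integral_contDiff_smul_eq_zero hf.locallyIntegrable fun g hg hgc => ?_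
  let G : SchwartzMap V ℂ := HasCompactSupport.toSchwartzMap (f := fun x => (g x : ℂ))
    (hgc.comp_left Complex.ofReal_zero) (Complex.ofRealCLM.contDiff.comp hg)
  let H : SchwartzMap V ℂ := 𝓕⁻ G
  calc ∫ x, g x • f x = ∫ x, (𝓕 H) x • f x := by
        rw [FourierTransform.fourier_fourierInv_eq]; rfl
    _ = ∫ ξ, H ξ • 𝓕 f ξ := by
        simpa [SchwartzMap.fourier_coe] using!
          VectorFourier.integral_bilin_fourierIntegral_eq_flip (.lsmul ℂ ℂ) (L := innerₗ V)
            Real.continuous_fourierChar continuous_inner H.integrable hf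
    _ = 0 := by simp [h]

theorem ae_eq_zero_of_laplace_eq_zero (hf : IntegrableOn (twist 1 f) (Ioi 1))
    (h : ∀ s : ℂ, 0 < s.re → laplace f s = 0) : ∀ᵐ x : ℝ, 1 < x → f x = 0 := by
  have hzero := ae_eq_zero_of_fourier_eq_zero (hf.integrable_indicator measurableSet_Ioi) <| by
    ext ξ
    rw [Real.fourier_real_eq, Pi.zero_apply, ← h (1 + 2 * Real.pi * ξ * Complex.I) (by simp),
      laplace, ← integral_indicator measurableSet_Ioi]
    congr 1 with x
    by_cases hx : x ∈ Ioi (1 : ℝ)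
    · simp only [hx, indicator_of_mem, twist, Circle.smul_def, Real.fourierChar_apply,
        smul_eq_mul, ← mul_assoc, ← Complex.exp_add]
      congr 2
      push_cast
      ring
    · simp [hx]
  filter_upwards [hzero] with x hx hx1
  simpa [hx1, twist] using hx

theorem integrableOn_exp_neg_mul (hs : 0 < s.re) :
    IntegrableOn (fun x : ℝ => Complex.exp (-(s * x))) (Ioi 1) := by
  simpa using integrableOn_exp_mul_complex_Ioi (a := -s) (by simpa using hs) 1

theorem setIntegral_Ioo_exp_neg_mul (hs : s ≠ 0) {a b : ℝ} (hab : a ≤ b) :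
    ∫ x in Ioo a b, Complex.exp (-(s * x)) =
      s⁻¹ * (Complex.exp (-(s * a)) - Complex.exp (-(s * b))) := by
  rw [← integral_Ioc_eq_integral_Ioo, ← intervalIntegral.integral_of_le hab]
  simp only [← neg_mul]
  rw [integral_exp_mul_complex (neg_ne_zero.2 hs)]
  field

theorem LaplaceIntegrable.of_bounded {C : ℝ}
    (hf : AEStronglyMeasurable f (volume.restrict (Ioi 1))) (hC : ∀ x, |f x| ≤ C) :
    LaplaceIntegrable f := fun _ hs =>
  (integrableOn_exp_neg_mul hs).integrable.mul_bdd (c := C)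
    (Complex.continuous_ofReal.comp_aestronglyMeasurable hf)
    (.of_forall fun x => by simpa using hC x)

theorem LaplaceIntegrable.of_integrable (hf : Integrable f) : LaplaceIntegrable f := fun s hs => by
  refine Integrable.bdd_mul (c := 1) hf.ofReal.integrableOn (by fun_prop) ?_
  filter_upwards [ae_restrict_mem measurableSet_Ioi] with x hx
  have hsx : 0 < s.re * x := mul_pos hs (zero_lt_one.trans hx)
  simpa [Complex.norm_exp] using hsx.le

theorem laplaceIntegrable_tail (hf : Integrable f) : LaplaceIntegrable (tail f) :=
  .of_bounded (continuous_tail hf).aestronglyMeasurable (abs_tail_le hf)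

-- Fubini on the triangle `1 < x < y`.
theorem mul_laplace_tail (hf : Integrable f) (hs : 0 < s.re) :
    s * laplace (tail f) s = Complex.exp (-s) * tail f 1 - laplace f s := by
  have hs0 : s ≠ 0 := by rintro rfl; simp at hs
  let F (x y : ℝ) : ℂ := {q : ℝ × ℝ | q.1 < q.2}.indicator
    (fun q => Complex.exp (-(s * q.1)) * f q.2) (x, y)
  have hF : Integrable (Function.uncurry F)
      ((volume.restrict (Ioi (1 : ℝ))).prod (volume.restrict (Ioi (1 : ℝ)))) :=
    ((integrableOn_exp_neg_mul hs).integrable.mul_prod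
      (hf.ofReal (𝕜 := ℂ)).integrableOn).indicator (measurableSet_lt measurable_fst measurable_snd)
  have hinner_y : ∀ x ∈ Ioi (1 : ℝ), ∫ y in Ioi (1 : ℝ), F x y = twist s (tail f) x := by
    intro x hx
    have hFx : F x = (Ioi x).indicator fun y => Complex.exp (-(s * x)) * f y := by
      ext y; simp [F, indicator]
    rw [hFx, setIntegral_indicator measurableSet_Ioi,
      inter_eq_self_of_subset_right (Ioi_subset_Ioi (le_of_lt hx)), integral_const_mul,
      integral_complex_ofReal, twist, tail]
  have hinner_x : ∀ y ∈ Ioi (1 : ℝ), ∫ x in Ioi (1 : ℝ), F x y =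
      s⁻¹ * (Complex.exp (-s) * f y - twist s f y) := by
    intro y hy
    have hFy : (F · y) = (Iio y).indicator fun x => Complex.exp (-(s * x)) * f y := by
      ext x; simp [F, indicator]
    rw [hFy, setIntegral_indicator measurableSet_Iio, Ioi_inter_Iio, integral_mul_const,
      setIntegral_Ioo_exp_neg_mul hs0 (le_of_lt hy), twist, Complex.ofReal_one, mul_one]
    ring
  have hint : Integrable (fun y => Complex.exp (-s) * (f y : ℂ)) (volume.restrict (Ioi 1)) :=
    hf.ofReal.integrableOn.integrable.const_mul _
  calc s * laplace (tail f) s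
      = s * ∫ y in Ioi (1 : ℝ), ∫ x in Ioi (1 : ℝ), F x y := by
        rw [laplace, ← setIntegral_congr_fun measurableSet_Ioi hinner_y, integral_integral_swap hF]
    _ = ∫ y in Ioi (1 : ℝ), (Complex.exp (-s) * f y - twist s f y) := by
        rw [setIntegral_congr_fun measurableSet_Ioi hinner_x, integral_const_mul,
          mul_inv_cancel_left₀ hs0]
    _ = Complex.exp (-s) * tail f 1 - laplace f s := by
        rw [integral_sub hint (LaplaceIntegrable.of_integrable hf s hs), integral_const_mul,
          integral_complex_ofReal, tail, laplace]

theorem wStar_of_one_le {x : ℝ} (hx : 1 ≤ x) : wStar x = 1 / x := by simp [wStar, hx]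

theorem measurable_wStar : Measurable wStar :=
  (measurable_const.div measurable_id).indicator measurableSet_Ici

theorem abs_wStar_le_one (x : ℝ) : |wStar x| ≤ 1 := by
  by_cases hx : 1 ≤ x
  · rw [wStar_of_one_le hx, one_div, abs_inv]
    exact inv_le_one_of_one_le₀ (hx.trans (le_abs_self x))
  · simp [wStar, hx]

theorem laplaceIntegrable_wStar : LaplaceIntegrable wStar :=
  .of_bounded measurable_wStar.aestronglyMeasurable abs_wStar_le_one

theorem laplace_id_mul_wStar (hs : 0 < s.re) :
    laplace (fun x => x * wStar x) s = Complex.exp (-s) / s := by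
  have htwist : ∀ x ∈ Ioi (1 : ℝ), twist s (fun x => x * wStar x) x = Complex.exp (-s * x) := by
    intro x hx
    rw [twist, wStar_of_one_le (le_of_lt hx), mul_one_div_cancel (zero_lt_one.trans hx).ne']
    simp
  rw [laplace, setIntegral_congr_fun measurableSet_Ioi htwist,
    integral_exp_mul_complex_Ioi (by simpa using hs)]
  simp

theorem hasDerivAt_laplace_wStar (hs : 0 < s.re) :
    HasDerivAt (laplace wStar) (-(Complex.exp (-s) / s)) s := by
  rw [← laplace_id_mul_wStar hs]
  exact laplaceIntegrable_wStar.hasDerivAt hs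

/-! ### The primitive of `1 / (1 - Q)` -/

theorem norm_Qpoly_le (hp_nonneg : ∀ j ∈ Finset.Icc 1 N, 0 ≤ p j)
    (hp_sum : ∑ j ∈ Finset.Icc 1 N, p j = 1) {z : ℂ} (hz : ‖z‖ ≤ 1) : ‖Qpoly N p z‖ ≤ ‖z‖ := by
  calc ‖Qpoly N p z‖ ≤ ∑ j ∈ Finset.Icc 1 N, p j * ‖z‖ := by
        refine norm_sum_le_of_le _ fun j hj => ?_
        rw [norm_mul, norm_pow, Complex.norm_real, Real.norm_of_nonneg (hp_nonneg j hj)]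
        have hj0 : j ≠ 0 := Nat.one_le_iff_ne_zero.1 (Finset.mem_Icc.1 hj).1
        exact mul_le_mul_of_nonneg_left (pow_le_of_le_one (norm_nonneg _) hz hj0) (hp_nonneg j hj)
    _ = ‖z‖ := by rw [← Finset.sum_mul, hp_sum, one_mul]

theorem one_sub_Qpoly_ne_zero (hp_nonneg : ∀ j ∈ Finset.Icc 1 N, 0 ≤ p j)
    (hp_sum : ∑ j ∈ Finset.Icc 1 N, p j = 1) {z : ℂ} (hz : ‖z‖ < 1) : 1 - Qpoly N p z ≠ 0 := by
  intro h
  have hQ := (norm_Qpoly_le hp_nonneg hp_sum hz.le).trans_lt hz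
  simp [← sub_eq_zero.1 h] at hQ

theorem hasDerivAt_segmentIntegral {h : ℂ → ℂ} {r : ℝ} {z : ℂ}
    (hh : DifferentiableOn ℂ h (Metric.ball 0 r)) (hz : z ∈ Metric.ball 0 r) :
    HasDerivAt (fun w => w * ∫ t in (0 : ℝ)..1, h (t * w)) (h z) z := by
  obtain ⟨H, hH⟩ := hh.isExactOn_ball
  have hsegment : ∀ w ∈ Metric.ball (0 : ℂ) r, ∀ t ∈ Icc (0 : ℝ) 1,
      0 + t • w ∈ Metric.ball (0 : ℂ) r := by
    intro w hw t ht
    rw [zero_add]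
    exact ((convex_ball 0 r).starConvex
      (Metric.mem_ball_self (Metric.pos_of_mem_ball hw))).smul_mem hw ht.1 ht.2
  have hprim : ∀ w ∈ Metric.ball (0 : ℂ) r, w * ∫ t in (0 : ℝ)..1, h (t * w) = H w - H 0 := by
    intro w hw
    simpa using intervalIntegral.integral_unitInterval_deriv_eq_sub
      (hh.continuousOn.comp (by fun_prop) (hsegment w hw)) fun t ht => hH _ (hsegment w hw t ht)
  refine ((hH z hz).sub_const (H 0)).congr_of_eventuallyEq ?_
  filter_upwards [Metric.isOpen_ball.mem_nhds hz] with w hw using hprim w hw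

theorem phi_zero (N : ℕ) (p : ℕ → ℝ) : phi N p 0 = 0 := by simp [phi]

theorem hasDerivAt_phi (hp_nonneg : ∀ j ∈ Finset.Icc 1 N, 0 ≤ p j)
    (hp_sum : ∑ j ∈ Finset.Icc 1 N, p j = 1) {z : ℂ} (hz : ‖z‖ < 1) :
    HasDerivAt (phi N p) (1 / (1 - Qpoly N p z)) z := by
  have hQ : Differentiable ℂ (Qpoly N p) := by unfold Qpoly; fun_prop
  have hdiff : DifferentiableOn ℂ (fun w => 1 / (1 - Qpoly N p w)) (Metric.ball 0 1) :=
    (differentiableOn_const _).div (by fun_prop) fun w hw =>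
      one_sub_Qpoly_ne_zero hp_nonneg hp_sum (mem_ball_zero_iff.1 hw)
  have hphi : phi N p = fun w => w * ∫ t in (0 : ℝ)..1, 1 / (1 - Qpoly N p (t * w)) := by
    ext w
    simp only [phi, ← intervalIntegral.integral_const_mul, mul_one_div]
  rw [hphi]
  exact hasDerivAt_segmentIntegral hdiff (mem_ball_zero_iff.2 hz)

/-! ### The integrated equation and the differential equation -/

/-- The steady-state equation integrated from `y` to `∞`: `y f(y) = β ∫_y^∞ T₁ℚ[f]` for almost
every `y > 1`. All three characterisations of steady states are compared with it. -/
def SteadyRelation (N : ℕ) (p : ℕ → ℝ) (β : ℝ) (f : ℝ → ℝ) : Prop :=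
  ∀ᵐ y : ℝ, 1 < y → y * f y = β * tail (shift (nonlin N p f)) y

/-- Probability densities on `(1, ∞)`, as functions on `ℝ` extended by zero. -/
structure IsDensity (f : ℝ → ℝ) : Prop where
  integrable : Integrable f
  eq_zero : ∀ᵐ y : ℝ, y < 1 → f y = 0
  nonneg : ∀ᵐ y : ℝ, 0 ≤ f y
  integral_eq_one : ∫ y, f y = 1

theorem isDensity_of_mem_probDensities {f : L1} (hf : f ∈ probDensities) : IsDensity f where
  integrable := L1.integrable_coeFn f
  eq_zero := hf.1
  nonneg := hf.2.1
  integral_eq_one := by rw [← setIntegral_Ioi_one_eq_integral hf.1]; exact hf.2.2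

theorem IsDensity.integrable_shift_nonlin (hf : IsDensity f) (N : ℕ) (p : ℕ → ℝ) :
    Integrable (shift (nonlin N p f)) :=
  integrable_shift (integrable_nonlin N p hf.integrable)

theorem shift_of_lt_two {y : ℝ} (hy : y < 2) : shift f y = 0 := by simp [shift, hy]

theorem IsDensity.tail_shift_nonlin_of_le_two (hf : IsDensity f)
    (hp_sum : ∑ j ∈ Finset.Icc 1 N, p j = 1) {y : ℝ} (hy : y ≤ 2) :
    tail (shift (nonlin N p f)) y = 1 := by
  rw [← integral_shift_nonlin hp_sum hf.integrable hf.eq_zero hf.integral_eq_one, tail,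
    ← integral_Ici_eq_integral_Ioi]
  exact setIntegral_eq_integral_of_forall_compl_eq_zero fun x hx =>
    shift_of_lt_two ((not_le.1 hx).trans_le hy)

theorem indicator_Ici_one_ae_eq (hf : ∀ᵐ y : ℝ, y < 1 → f y = 0)
    (hfg : ∀ᵐ y : ℝ, 1 < y → f y = g y) : (Ici (1 : ℝ)).indicator g =ᵐ[volume] f := by
  filter_upwards [hf, hfg, Measure.ae_ne volume (1 : ℝ)] with x hx_lt hx_gt hx
  rcases lt_or_gt_of_ne hx with h | h
  · simp [hx_lt h, h]
  · simp [hx_gt h, h.le]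

theorem SolvesSteadyODE.steadyRelation {β : ℝ} (hg : SolvesSteadyODE N p β g)
    (hp_sum : ∑ j ∈ Finset.Icc 1 N, p j = 1) (hf : IsDensity f)
    (hfg : ∀ᵐ y : ℝ, 1 < y → f y = g y) : SteadyRelation N p β f := by
  have hshift : shift (nonlin N p ((Ici 1).indicator g)) =ᵐ[volume] shift (nonlin N p f) :=
    shift_congr (nonlin_congr N p (indicator_Ici_one_ae_eq hf.eq_zero hfg))
  filter_upwards [hfg] with y hy h1
  have hderiv : ∫ x in (1 : ℝ)..y, deriv (fun y => y * g y) x =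
      ∫ x in (1 : ℝ)..y, -(β * shift (nonlin N p f) x) := by
    refine intervalIntegral.integral_congr_ae ?_
    filter_upwards [hg.ode, hshift] with x hx hx_shift hx_mem
    rw [uIoc_of_le h1.le] at hx_mem
    rw [(hx hx_mem.1).deriv, hx_shift]
  rw [(hg.absCont y h1).integral_deriv_eq_sub, intervalIntegral.integral_neg,
    intervalIntegral.integral_const_mul, ← tail_sub_tail (hf.integrable_shift_nonlin N p),
    hf.tail_shift_nonlin_of_le_two hp_sum one_le_two, hg.initial] at hderiv
  rw [hy h1]
  linarith

theorem SteadyRelation.exists_solvesSteadyODE {β : ℝ} (h : SteadyRelation N p β f)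
    (hp_sum : ∑ j ∈ Finset.Icc 1 N, p j = 1) (hf : IsDensity f) :
    ∃ g : ℝ → ℝ, SolvesSteadyODE N p β g ∧ ∀ᵐ y : ℝ, 1 < y → f y = g y := by
  have hint := hf.integrable_shift_nonlin N p
  set k := shift (nonlin N p f)
  have hfg : ∀ᵐ y : ℝ, 1 < y → f y = β * tail k y / y := by
    filter_upwards [h] with y hy h1
    rw [← hy h1, mul_div_cancel_left₀ _ (by positivity)]
  have hmul : ∀ y : ℝ, 0 < y → β * tail k y = y * (β * tail k y / y) :=
    fun y hy => (mul_div_cancel₀ _ hy.ne').symm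
  refine ⟨fun y => β * tail k y / y, ⟨?_, fun R hR => ?_, ?_⟩, hfg⟩
  · rw [hf.tail_shift_nonlin_of_le_two hp_sum one_le_two, mul_one, div_one]
  · refine absolutelyContinuousOnInterval_congr
      ((absolutelyContinuousOnInterval_tail hint 1 R).const_mul β) fun y hy => ?_
    rw [uIcc_of_le hR.le] at hy
    exact hmul y (by linarith [hy.1])
  · filter_upwards [ae_hasDerivAt_tail hint,
      shift_congr (nonlin_congr N p (indicator_Ici_one_ae_eq hf.eq_zero hfg))] with y hy hy_shift h1
    rw [hy_shift, ← mul_neg]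
    refine (hy.const_mul β).congr_of_eventuallyEq ?_
    filter_upwards [lt_mem_nhds (zero_lt_one.trans h1)] with z hz using (hmul z hz).symm

/-! ### The integrated equation and the transform `𝒩` -/

theorem IsDensity.norm_laplace_lt_one (hf : IsDensity f) (hs : 0 < s.re) : ‖laplace f s‖ < 1 := by
  calc ‖laplace f s‖ ≤ ∫ x in Ioi (1 : ℝ), Real.exp (-s.re) * f x := by
        refine norm_integral_le_of_norm_le (hf.integrable.integrableOn.const_mul _) ?_
        filter_upwards [ae_restrict_mem measurableSet_Ioi, ae_restrict_of_ae hf.nonneg] with x hx h0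
        rw [norm_twist, abs_of_nonneg h0]
        refine mul_le_mul_of_nonneg_right (Real.exp_le_exp.2 ?_) h0
        exact neg_le_neg (le_mul_of_one_le_right hs.le (le_of_lt hx))
    _ = Real.exp (-s.re) := by
        rw [integral_const_mul, setIntegral_Ioi_one_eq_integral hf.eq_zero, hf.integral_eq_one,
          mul_one]
    _ < 1 := Real.exp_lt_one_iff.2 (neg_lt_zero.2 hs)

theorem IsDensity.laplaceIntegrable (hf : IsDensity f) : LaplaceIntegrable f :=
  .of_integrable hf.integrable

theorem twist_ae_eq_zero (s : ℂ) (hf : ∀ᵐ y : ℝ, y < 1 → f y = 0) :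
    ∀ᵐ y : ℝ, y < 1 → twist s f y = 0 := by
  filter_upwards [hf] with x hx hx1
  simp [twist, hx hx1]

theorem laplace_eq_integral (hf : ∀ᵐ y : ℝ, y < 1 → f y = 0) (s : ℂ) :
    laplace f s = ∫ x, twist s f x :=
  setIntegral_Ioi_one_eq_integral (twist_ae_eq_zero s hf)

theorem LaplaceIntegrable.integrable_twist (hf : LaplaceIntegrable f)
    (hf0 : ∀ᵐ y : ℝ, y < 1 → f y = 0) (hs : 0 < s.re) : Integrable (twist s f) := by
  have hIci : IntegrableOn (twist s f) (Ici 1) :=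
    (integrableOn_Ici_iff_integrableOn_Ioi (by simp)).2 (hf s hs)
  refine hIci.integrable_of_ae_notMem_eq_zero ?_
  filter_upwards [twist_ae_eq_zero s hf0] with x hx hx1 using hx (not_le.1 hx1)

theorem IsDensity.laplace_tail_shift_nonlin (hf : IsDensity f)
    (hp_sum : ∑ j ∈ Finset.Icc 1 N, p j = 1) (hs : 0 < s.re) :
    laplace (tail (shift (nonlin N p f))) s =
      Complex.exp (-s) / s * (1 - Qpoly N p (laplace f s)) := by
  have hs0 : s ≠ 0 := by rintro rfl; simp at hs
  have hlaplace :
      laplace (shift (nonlin N p f)) s = Complex.exp (-s) * Qpoly N p (laplace f s) := by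
    rw [laplace_eq_integral (.of_forall fun y hy => shift_of_lt_two (by linarith)),
      integral_twist_shift (nonlin_ae_eq_zero N p hf.eq_zero),
      integral_twist_nonlin N p (hf.laplaceIntegrable.integrable_twist hf.eq_zero hs),
      laplace_eq_integral hf.eq_zero]
  have htail := mul_laplace_tail (hf.integrable_shift_nonlin N p) hs
  rw [hf.tail_shift_nonlin_of_le_two hp_sum one_le_two, hlaplace, Complex.ofReal_one] at htail
  rw [div_mul_eq_mul_div, eq_div_iff hs0, mul_comm, htail]
  ring

theorem IsDensity.laplaceIntegrable_id_mul_sub (hf : IsDensity f) (N : ℕ) (p : ℕ → ℝ) (β : ℝ) :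
    LaplaceIntegrable fun x => x * f x - β * tail (shift (nonlin N p f)) x := fun s hs => by
  rw [twist_sub, twist_const_mul]
  exact (hf.laplaceIntegrable.id_mul s hs).sub
    ((laplaceIntegrable_tail (hf.integrable_shift_nonlin N p) s hs).integrable.const_mul _)

-- Since `φ' = 1 / (1 - Q)` and `L (T₁ℚ[f]) = e^{-s} Q (L f)`, the factor `1 - Q (L f)` cancels from
-- the term coming from the tail, which leaves the derivative `-e^{-s} / s` of `L w*`.
theorem IsDensity.hasDerivAt_phi_laplace_sub (hf : IsDensity f)
    (hp_nonneg : ∀ j ∈ Finset.Icc 1 N, 0 ≤ p j) (hp_sum : ∑ j ∈ Finset.Icc 1 N, p j = 1) (β : ℝ)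
    (hs : 0 < s.re) :
    HasDerivAt (fun s => phi N p (laplace f s) - β * laplace wStar s)
      (-laplace (fun x => x * f x - β * tail (shift (nonlin N p f)) x) s /
        (1 - Qpoly N p (laplace f s))) s := by
  have hnorm := hf.norm_laplace_lt_one hs
  have hne := one_sub_Qpoly_ne_zero hp_nonneg hp_sum hnorm
  have htail := (laplaceIntegrable_tail (hf.integrable_shift_nonlin N p) s hs).integrable.const_mul
    (β : ℂ)
  rw [← twist_const_mul] at htail
  convert! ((hasDerivAt_phi hp_nonneg hp_sum hnorm).comp s
    (hf.laplaceIntegrable.hasDerivAt hs)).fun_sub ((hasDerivAt_laplace_wStar hs).const_mul (β : ℂ))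
    using 1
  rw [laplace_sub (hf.laplaceIntegrable.id_mul s hs) htail, laplace_const_mul,
    hf.laplace_tail_shift_nonlin hp_sum hs]
  field

theorem eq_of_hasDerivAt_zero_of_tendsto {E : Type*} [NormedAddCommGroup E] [NormedSpace ℂ E]
    {F : ℂ → E} {c : E} (hF : ∀ s : ℂ, 0 < s.re → HasDerivAt F 0 s)
    (hlim : Tendsto (fun t : ℝ => F t) atTop (𝓝 c)) (hs : 0 < s.re) : F s = c := by
  have hopen : IsOpen {s : ℂ | 0 < s.re} := isOpen_lt continuous_const Complex.continuous_re
  have hconst : ∀ t : ℂ, 0 < t.re → F s = F t := fun t ht =>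
    hopen.is_const_of_deriv_eq_zero (convex_halfSpace_re_gt 0).isPreconnected
      (fun s hs => (hF s hs).differentiableAt.differentiableWithinAt)
      (fun s hs => (hF s hs).deriv) hs ht
  refine tendsto_nhds_unique (tendsto_const_nhds.congr' ?_) hlim
  filter_upwards [eventually_gt_atTop 0] with t ht using hconst t (by simpa using ht)

theorem SteadyRelation.phi_laplace {β : ℝ} (h : SteadyRelation N p β f)
    (hp_nonneg : ∀ j ∈ Finset.Icc 1 N, 0 ≤ p j) (hp_sum : ∑ j ∈ Finset.Icc 1 N, p j = 1)
    (hf : IsDensity f) (hs : 0 < s.re) : phi N p (laplace f s) = β * laplace wStar s := by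
  refine sub_eq_zero.1 (eq_of_hasDerivAt_zero_of_tendsto
    (F := fun s => phi N p (laplace f s) - β * laplace wStar s) (fun s hs => ?_) ?_ hs)
  · have hdefect : laplace (fun x => x * f x - β * tail (shift (nonlin N p f)) x) s = 0 := by
      rw [laplace_congr (g := 0) (h.mono fun x hx hx1 => sub_eq_zero.2 (hx hx1))]
      simp [laplace, twist]
    simpa [hdefect] using hf.hasDerivAt_phi_laplace_sub hp_nonneg hp_sum β hs
  · have hphi : Tendsto (fun t : ℝ => phi N p (laplace f t)) atTop (𝓝 (phi N p 0)) :=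
      (hasDerivAt_phi hp_nonneg hp_sum (by simp)).continuousAt.tendsto.comp
        hf.laplaceIntegrable.tendsto_zero
    simpa [phi_zero] using hphi.sub (laplaceIntegrable_wStar.tendsto_zero.const_mul (β : ℂ))

theorem steadyRelation_of_phi_laplace {β : ℝ} (hp_nonneg : ∀ j ∈ Finset.Icc 1 N, 0 ≤ p j)
    (hp_sum : ∑ j ∈ Finset.Icc 1 N, p j = 1) (hf : IsDensity f)
    (h : ∀ s : ℂ, 0 < s.re → phi N p (laplace f s) = β * laplace wStar s) :
    SteadyRelation N p β f := by
  have hdefect : ∀ᵐ x : ℝ, 1 < x → x * f x - β * tail (shift (nonlin N p f)) x = 0 := by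
    refine ae_eq_zero_of_laplace_eq_zero (hf.laplaceIntegrable_id_mul_sub N p β 1 (by simp))
      fun s hs => ?_
    have hzero : (fun s => phi N p (laplace f s) - β * laplace wStar s) =ᶠ[𝓝 s] fun _ => 0 := by
      filter_upwards [(isOpen_lt continuous_const Complex.continuous_re).mem_nhds hs] with t ht
      exact sub_eq_zero.2 (h t ht)
    have hderiv := (hf.hasDerivAt_phi_laplace_sub hp_nonneg hp_sum β hs).unique
      ((hasDerivAt_const s 0).congr_of_eventuallyEq hzero)
    have hne := one_sub_Qpoly_ne_zero hp_nonneg hp_sum (hf.norm_laplace_lt_one hs)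
    simpa [hne] using hderiv
  filter_upwards [hdefect] with x hx hx1 using sub_eq_zero.1 (hx hx1)

theorem IsTransformOf.laplaceIntegrable (h : IsTransformOf N p f g) : LaplaceIntegrable g :=
  fun s hs => by
    have hint := h.integrable (-(Complex.I * s)) (by simpa using hs)
    simp only [mul_neg, ← mul_assoc, Complex.I_mul_I, neg_mul, one_mul, neg_neg] at hint
    exact hint

theorem IsTransformOf.laplace_eq (h : IsTransformOf N p f g) (hs : 0 < s.re) :
    laplace g s = phi N p (laplace f s) := by
  have hphi := h.transform_eq (-(Complex.I * s)) (by simpa using hs)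
  simpa only [fourierLaplace_eq_laplace, mul_neg, ← mul_assoc, Complex.I_mul_I, neg_mul, one_mul,
    neg_neg] using hphi

theorem IsTransformOf.ae_eq {g₁ g₂ : ℝ → ℝ} (h₁ : IsTransformOf N p f g₁)
    (h₂ : IsTransformOf N p f g₂) : g₁ =ᵐ[volume] g₂ := by
  have hint : IntegrableOn (twist 1 fun x => g₁ x - g₂ x) (Ioi 1) := by
    rw [twist_sub]
    exact (h₁.laplaceIntegrable 1 (by simp)).sub (h₂.laplaceIntegrable 1 (by simp))
  have hdiff := ae_eq_zero_of_laplace_eq_zero hint fun s hs => by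
    rw [laplace_sub (h₁.laplaceIntegrable s hs) (h₂.laplaceIntegrable s hs), h₁.laplace_eq hs,
      h₂.laplace_eq hs, sub_self]
  filter_upwards [hdiff, Measure.ae_ne volume (1 : ℝ)] with x hx hx1
  rcases lt_or_gt_of_ne hx1 with h | h
  · rw [h₁.eq_zero x h, h₂.eq_zero x h]
  · exact sub_eq_zero.1 (hx h)

theorem IsTransformOf.calN_ae_eq (h : IsTransformOf N p f g) : calN N p f =ᵐ[volume] g := by
  have hex : ∃ w, IsTransformOf N p f w := ⟨g, h⟩
  rw [calN, dif_pos hex]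
  exact hex.choose_spec.ae_eq h

theorem isTransformOf_calN (h : ¬ calN N p f =ᵐ[volume] 0) : IsTransformOf N p f (calN N p f) := by
  have hex : ∃ w, IsTransformOf N p f w := by
    by_contra hex
    exact h (by rw [calN, dif_neg hex])
  rw [calN, dif_pos hex]
  exact hex.choose_spec

theorem SteadyRelation.isTransformOf {β : ℝ} (h : SteadyRelation N p β f)
    (hp_nonneg : ∀ j ∈ Finset.Icc 1 N, 0 ≤ p j) (hp_sum : ∑ j ∈ Finset.Icc 1 N, p j = 1)
    (hf : IsDensity f) : IsTransformOf N p f fun y => β * wStar y where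
  locallyIntegrable :=
    (((locallyIntegrable_const (1 : ℝ)).mono measurable_wStar.aestronglyMeasurable
      (.of_forall fun x => by simpa using abs_wStar_le_one x)).smul β).locallyIntegrableOn _
  eq_zero x hx := by simp [wStar, hx]
  integrable ξ hξ := by
    change IntegrableOn (twist (Complex.I * ξ) fun y => β * wStar y) (Ioi 1)
    rw [twist_const_mul]
    exact (laplaceIntegrable_wStar (Complex.I * ξ) (by simpa using hξ)).integrable.const_mul _
  transform_eq ξ hξ := by
    rw [fourierLaplace_eq_laplace, fourierLaplace_eq_laplace, laplace_const_mul,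
      h.phi_laplace hp_nonneg hp_sum hf (by simpa using hξ)]

theorem not_const_mul_wStar_ae_eq_zero {β : ℝ} (hβ : β ≠ 0) :
    ¬ (fun y => β * wStar y) =ᵐ[volume] 0 := by
  intro h
  have hnull : ∀ᵐ y : ℝ, y ∉ Ioi (1 : ℝ) := by
    filter_upwards [h] with y hy hy1
    have hwStar : wStar y ≠ 0 := by
      rw [wStar_of_one_le (le_of_lt hy1)]
      exact one_div_ne_zero (zero_lt_one.trans hy1).ne'
    exact mul_ne_zero hβ hwStar hy
  simpa using measure_eq_zero_iff_ae_notMem.2 hnull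

theorem steadyRelation_of_calN_ae_eq {β : ℝ} (hp_nonneg : ∀ j ∈ Finset.Icc 1 N, 0 ≤ p j)
    (hp_sum : ∑ j ∈ Finset.Icc 1 N, p j = 1) (hf : IsDensity f) (hβ : β ≠ 0)
    (h : calN N p f =ᵐ[volume] fun y => β * wStar y) : SteadyRelation N p β f := by
  have htransform : IsTransformOf N p f (calN N p f) :=
    isTransformOf_calN fun h0 => not_const_mul_wStar_ae_eq_zero hβ (h.symm.trans h0)
  refine steadyRelation_of_phi_laplace hp_nonneg hp_sum hf fun s hs => ?_
  rw [← htransform.laplace_eq hs, laplace_congr (h.mono fun y hy _ => hy), laplace_const_mul]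

/-! ### The operators on `L¹` -/

theorem norm_toL1_sub_toL1 (hf : Integrable f volume) (hg : Integrable g volume) :
    ‖hf.toL1 f - hg.toL1 g‖ = ∫ x, |f x - g x| := by
  rw [← Integrable.toL1_sub, L1.norm_of_fun_eq_integral_norm]
  rfl

theorem norm_sub_eq_integral (f g : L1) : ‖f - g‖ = ∫ x, |f x - g x| := by
  rw [← dist_eq_norm, L1.dist_eq_integral_dist]
  rfl

theorem norm_shiftL1_sub_le (f g : L1) : ‖shiftL1 f - shiftL1 g‖ ≤ ‖f - g‖ := by
  have hi : Integrable fun x => |f x - g x| :=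
    ((L1.integrable_coeFn f).sub (L1.integrable_coeFn g)).abs
  rw [shiftL1, shiftL1, norm_toL1_sub_toL1, norm_sub_eq_integral,
    ← integral_sub_right_eq_self (fun x => |f x - g x|) 1]
  refine integral_mono_of_nonneg (.of_forall fun _ => abs_nonneg _) (hi.comp_sub_right 1)
    (.of_forall fun x => ?_)
  by_cases h : (2 : ℝ) ≤ x <;> simp [shift, h]

theorem continuous_shiftL1 : Continuous shiftL1 :=
  (LipschitzWith.of_dist_le_mul (K := 1) fun f g => by
    simpa [dist_eq_norm] using norm_shiftL1_sub_le f g).continuous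

theorem rescale_of_one_le (τ : ℝ) (f : ℝ → ℝ) {x : ℝ} (hx : 1 ≤ x) :
    rescale τ f x = Real.exp τ * f (Real.exp τ * x) := by simp [rescale, hx]

theorem rescale_of_lt_one (τ : ℝ) (f : ℝ → ℝ) {x : ℝ} (hx : x < 1) : rescale τ f x = 0 := by
  simp [rescale, hx]

theorem integral_exp_mul_comp (τ : ℝ) (f : ℝ → ℝ) :
    ∫ x, Real.exp τ * f (Real.exp τ * x) = ∫ x, f x := by
  rw [integral_const_mul, Measure.integral_comp_mul_left, abs_of_pos (inv_pos.2 (Real.exp_pos τ)),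
    smul_eq_mul, mul_inv_cancel_left₀ (Real.exp_pos τ).ne']

theorem integral_abs_rescale_sub_le (τ : ℝ) (hf : Integrable f) (hg : Integrable g) :
    ∫ x, |rescale τ f x - rescale τ g x| ≤ ∫ x, |f x - g x| := by
  rw [← integral_exp_mul_comp τ fun x => |f x - g x|]
  refine integral_mono_of_nonneg (.of_forall fun _ => abs_nonneg _)
    (((hf.sub hg).abs.comp_mul_left' (Real.exp_pos τ).ne').const_mul _) (.of_forall fun x => ?_)
  rcases le_or_gt 1 x with hx | hx
  · simp [rescale_of_one_le, hx, ← mul_sub, abs_mul]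
  · simp only [rescale_of_lt_one, hx, sub_zero, abs_zero]
    positivity

theorem norm_rescaleL1_sub_le (τ : ℝ) (f g : L1) :
    ‖rescaleL1 τ f - rescaleL1 τ g‖ ≤ ‖f - g‖ := by
  rw [rescaleL1, rescaleL1, norm_toL1_sub_toL1, norm_sub_eq_integral]
  exact integral_abs_rescale_sub_le τ (L1.integrable_coeFn f) (L1.integrable_coeFn g)

theorem abs_rescale_le {C : ℝ} (hC : ∀ y, |y ^ 2 * f y| ≤ C) (τ x : ℝ) :
    |rescale τ f x| ≤ Real.exp (-τ) * (Ici (1 : ℝ)).indicator (fun x => C * x ^ (-2 : ℝ)) x := by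
  rcases le_or_gt 1 x with hx | hx
  · have hx0 : 0 < x := zero_lt_one.trans_le hx
    rw [rescale_of_one_le τ f hx, indicator_of_mem (mem_Ici.2 hx), Real.rpow_neg hx0.le,
      Real.rpow_two]
    calc |Real.exp τ * f (Real.exp τ * x)|
        = Real.exp (-τ) * (|(Real.exp τ * x) ^ 2 * f (Real.exp τ * x)| * (x ^ 2)⁻¹) := by
          rw [abs_mul, abs_mul, abs_of_pos (Real.exp_pos τ), abs_of_nonneg (sq_nonneg (_ * x)),
            Real.exp_neg]
          field
      _ ≤ Real.exp (-τ) * (C * (x ^ 2)⁻¹) := by gcongr; exact hC _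
  · simp [rescale_of_lt_one, hx]

theorem continuous_rescale_apply (hf : Continuous f) (x : ℝ) :
    Continuous fun τ => rescale τ f x := by
  rcases le_or_gt 1 x with hx | hx
  · simp only [rescale_of_one_le, hx]
    fun_prop
  · simp only [rescale_of_lt_one, hx]
    exact continuous_const

theorem continuous_toL1_rescale (hi : Integrable f) (hc : Continuous f)
    (hs : HasCompactSupport f) :
    Continuous fun τ => (integrable_rescale τ hi).toL1 (rescale τ f) := by
  refine continuous_iff_continuousAt.2 fun τ₀ => tendsto_iff_norm_sub_tendsto_zero.2 ?_
  simp only [norm_toL1_sub_toL1]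
  obtain ⟨C, hC⟩ := ((continuous_id.pow 2).mul hc).bounded_above_of_compact_support hs.mul_left
  set B := (Ici (1 : ℝ)).indicator fun x => C * x ^ (-2 : ℝ)
  have hB : Integrable B := by
    refine (integrable_indicator_iff measurableSet_Ici).2 ?_
    exact integrableOn_Ici_iff_integrableOn_Ioi (by simp) |>.2
      ((integrableOn_Ioi_rpow_of_lt (by norm_num) one_pos).const_mul C)
  have hB0 : ∀ x, 0 ≤ B x := fun x => by
    simpa only [neg_zero, Real.exp_zero, one_mul] using
      (abs_nonneg _).trans (abs_rescale_le hC 0 x)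
  have hlim := tendsto_integral_filter_of_dominated_convergence (μ := volume) (l := 𝓝 τ₀)
    (F := fun τ x => |rescale τ f x - rescale τ₀ f x|) (f := fun _ => 0)
    (fun x => Real.exp (1 - τ₀) * B x + Real.exp (-τ₀) * B x)
    (.of_forall fun τ => (((integrable_rescale τ hi).sub
      (integrable_rescale τ₀ hi)).abs).aestronglyMeasurable) ?_
    ((hB.const_mul _).add (hB.const_mul _)) (.of_forall fun x => ?_)
  · simpa using hlim
  · filter_upwards [lt_mem_nhds (sub_one_lt τ₀)] with τ hτ
    refine .of_forall fun x => ?_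
    rw [Real.norm_eq_abs, abs_abs]
    refine (abs_sub _ _).trans (add_le_add ((abs_rescale_le hC τ x).trans ?_)
      (abs_rescale_le hC τ₀ x))
    exact mul_le_mul_of_nonneg_right (Real.exp_le_exp.2 (by linarith)) (hB0 x)
  · exact ((continuous_rescale_apply hc x).sub continuous_const).abs.tendsto' τ₀ 0 (by simp)

theorem continuous_rescaleL1_left (f : L1) : Continuous fun τ => rescaleL1 τ f := by
  refine continuous_of_uniform_approx_of_continuous fun u hu => ?_
  obtain ⟨ε, hε, hu⟩ := Metric.mem_uniformity_dist.1 hu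
  obtain ⟨g, hgs, hfg, hgc, hgi⟩ :=
    (L1.integrable_coeFn f).exists_hasCompactSupport_integral_sub_le (half_pos hε)
  refine ⟨_, continuous_toL1_rescale hgi hgc hgs, fun τ => hu ?_⟩
  rw [dist_eq_norm, rescaleL1, norm_toL1_sub_toL1]
  exact (integral_abs_rescale_sub_le τ (L1.integrable_coeFn f) hgi).trans_lt
    (hfg.trans_lt (half_lt_self hε))

theorem continuous_rescaleL1 : Continuous fun q : L1 × ℝ => rescaleL1 q.2 q.1 :=
  continuous_prod_of_continuous_lipschitzWith _ 1 continuous_rescaleL1_left fun τ =>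
    LipschitzWith.of_dist_le_mul fun f g => by
      simpa [dist_eq_norm] using norm_rescaleL1_sub_le τ f g

theorem integral_abs_convolution_le (hf : Integrable f) (hg : Integrable g) :
    ∫ x, |(f ⋆[ContinuousLinearMap.mul ℝ ℝ, volume] g) x| ≤ (∫ x, |f x|) * ∫ x, |g x| := by
  rw [← ContinuousLinearMap.mul_apply' ℝ ℝ,
    ← integral_convolution (ContinuousLinearMap.mul ℝ ℝ) hf.abs hg.abs]
  refine integral_mono_of_nonneg (.of_forall fun _ => abs_nonneg _)
    (hf.abs.integrable_convolution _ hg.abs) (.of_forall fun x => ?_)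
  refine (abs_integral_le_integral_abs (μ := volume)).trans_eq ?_
  simp only [convolution_def, ContinuousLinearMap.mul_apply', abs_mul]

theorem integrable_convolution_coeFn (f g : L1) :
    Integrable (f ⋆[ContinuousLinearMap.mul ℝ ℝ, volume] g) :=
  (L1.integrable_coeFn f).integrable_convolution _ (L1.integrable_coeFn g)

theorem ae_convolutionExistsAt_coeFn (f g : L1) :
    ∀ᵐ x : ℝ, ConvolutionExistsAt f g x (ContinuousLinearMap.mul ℝ ℝ) volume :=
  (L1.integrable_coeFn f).ae_convolution_exists _ (L1.integrable_coeFn g)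

/-- Convolution as a bounded bilinear map on `L¹`. -/
noncomputable def convL1 : L1 →L[ℝ] L1 →L[ℝ] L1 :=
  LinearMap.mkContinuous₂
    (LinearMap.mk₂ ℝ (fun f g => (integrable_convolution_coeFn f g).toL1 _)
      (fun f f' g => by
        rw [← Integrable.toL1_add, Integrable.toL1_eq_toL1_iff,
          convolution_congr _ (Lp.coeFn_add f f') .rfl]
        filter_upwards [ae_convolutionExistsAt_coeFn f g, ae_convolutionExistsAt_coeFn f' g]
          with x hx hx' using hx.add_distrib hx')
      (fun c f g => by
        rw [← Integrable.toL1_smul', Integrable.toL1_eq_toL1_iff,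
          convolution_congr _ (Lp.coeFn_smul c f) .rfl, smul_convolution])
      (fun f g g' => by
        rw [← Integrable.toL1_add, Integrable.toL1_eq_toL1_iff,
          convolution_congr _ .rfl (Lp.coeFn_add g g')]
        filter_upwards [ae_convolutionExistsAt_coeFn f g, ae_convolutionExistsAt_coeFn f g']
          with x hx hx' using hx.distrib_add hx')
      (fun c f g => by
        rw [← Integrable.toL1_smul', Integrable.toL1_eq_toL1_iff,
          convolution_congr _ .rfl (Lp.coeFn_smul c g), convolution_smul]))
    1 fun f g => by
      rw [one_mul, LinearMap.mk₂_apply, L1.norm_of_fun_eq_integral_norm,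
        L1.norm_eq_integral_norm, L1.norm_eq_integral_norm]
      exact integral_abs_convolution_le (L1.integrable_coeFn f) (L1.integrable_coeFn g)

theorem convL1_toL1 (f : L1) (hg : Integrable g) :
    convL1 f (hg.toL1 g) = ((L1.integrable_coeFn f).integrable_convolution
      (ContinuousLinearMap.mul ℝ ℝ) hg).toL1 _ := by
  refine (Integrable.toL1_eq_toL1_iff _ _ (integrable_convolution_coeFn _ _) _).2 ?_
  rw [convolution_congr _ .rfl hg.coeFn_toL1]

theorem contDiff_toL1_convPow (k : ℕ) : ContDiff ℝ 1 fun f : L1 =>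
    (integrable_convPow (L1.integrable_coeFn f) k).toL1 _ := by
  induction k with
  | zero => simp only [convPow, Integrable.toL1_coeFn, contDiff_fun_id]
  | succ k ih =>
    simp only [convPow, ← convL1_toL1 _ (integrable_convPow (L1.integrable_coeFn _) k)]
    exact convL1.contDiff.clm_apply ih

theorem nonlinL1_eq_sum (N : ℕ) (p : ℕ → ℝ) (f : L1) : nonlinL1 N p f =
    ∑ j ∈ Finset.Icc 1 N, p j • (integrable_convPow (L1.integrable_coeFn f) (j - 1)).toL1 _ := by
  refine Lp.ext ((Integrable.coeFn_toL1 _).trans ?_)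
  have hsmul : ∀ j ∈ Finset.Icc 1 N, _ := fun j _ =>
    (Lp.coeFn_smul (p j) ((integrable_convPow (L1.integrable_coeFn f) (j - 1)).toL1 _)).trans
      ((integrable_convPow (L1.integrable_coeFn f) (j - 1)).coeFn_toL1.const_smul (p j))
  filter_upwards [Lp.coeFn_finsetSum (Finset.Icc 1 N) fun j =>
    p j • (integrable_convPow (L1.integrable_coeFn f) (j - 1)).toL1 _,
    (Finset.eventually_all _).2 hsmul] with x hsum hx
  rw [hsum, Finset.sum_apply]
  exact (Finset.sum_congr rfl hx).symm

theorem contDiff_nonlinL1 (N : ℕ) (p : ℕ → ℝ) : ContDiff ℝ 1 (nonlinL1 N p) := by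
  rw [funext (nonlinL1_eq_sum N p)]
  exact ContDiff.sum fun j _ => (contDiff_toL1_convPow (j - 1)).const_smul (p j)

theorem continuousOn_rescaleL1_shiftL1_nonlinL1 (N : ℕ) (p : ℕ → ℝ) {η : ℝ → L1} {S : Set ℝ}
    (hη : ContinuousOn η S) (τ : ℝ) :
    ContinuousOn (fun s => rescaleL1 (τ - s) (shiftL1 (nonlinL1 N p (η s)))) S :=
  continuous_rescaleL1.comp_continuousOn
    (((continuous_shiftL1.comp (contDiff_nonlinL1 N p).continuous).comp_continuousOn hη).prodMk
      (by fun_prop))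

/-- The tail `f ↦ ∫_a^∞ f` as a continuous linear functional on `L¹`. -/
noncomputable def tailCLM (a : ℝ) : L1 →L[ℝ] ℝ :=
  L1.integralCLM.comp (LpToLpRestrictCLM ℝ ℝ ℝ volume 1 (Ioi a))

theorem tailCLM_apply (a : ℝ) (f : L1) : tailCLM a f = tail f a := by
  rw [tail, ← integral_congr_ae (LpToLpRestrictCLM_coeFn ℝ (Ioi a) f), ← L1.integral_eq_integral,
    L1.integral_eq]
  rfl

theorem tail_rescale (τ : ℝ) (f : ℝ → ℝ) (a : ℝ) :
    tail (rescale τ f) a = tail f (Real.exp τ * max a 1) := by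
  have hIoi : rescale τ f =ᵐ[volume]
      (Ioi (1 : ℝ)).indicator fun y => Real.exp τ * f (Real.exp τ * y) :=
    indicator_ae_eq_of_ae_eq_set Ioi_ae_eq_Ici.symm
  rw [tail_congr hIoi, tail, setIntegral_indicator measurableSet_Ioi, Ioi_inter_Ioi,
    integral_const_mul, integral_comp_mul_left_Ioi _ _ (Real.exp_pos τ), smul_eq_mul,
    mul_inv_cancel_left₀ (Real.exp_pos τ).ne', tail]

theorem tail_rescaleL1 (τ : ℝ) (f : L1) (a : ℝ) :
    tail (rescaleL1 τ f) a = tail f (Real.exp τ * max a 1) := by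
  rw [← tail_rescale]
  exact congrFun (tail_congr (Integrable.coeFn_toL1 _)) a

theorem tail_max_one (hi : Integrable f) (hf : ∀ᵐ y : ℝ, y < 1 → f y = 0) (a : ℝ) :
    tail f (max a 1) = tail f a := by
  rcases le_total a 1 with h | h
  · rw [max_eq_right h, eq_comm, ← sub_eq_zero, tail_sub_tail hi, intervalIntegral.integral_of_le h,
      integral_Ioc_eq_integral_Ioo]
    exact setIntegral_eq_zero_of_ae_eq_zero (hf.mono fun x hx hx' => hx hx'.2)
  · rw [max_eq_left h]

theorem eq_of_tail_eq {f g : L1} (h : tail f = tail g) : f = g := by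
  refine Lp.ext ?_
  filter_upwards [ae_hasDerivAt_tail (L1.integrable_coeFn f),
    ae_hasDerivAt_tail (L1.integrable_coeFn g)] with x hf hg
  exact neg_injective (hf.unique (h ▸ hg))

/-! ### The integrated equation and the evolution equation -/

theorem integral_tail_exp_mul (hf : Integrable f) {m : ℝ} (hm : 0 < m) (τ : ℝ) :
    ∫ s in (0 : ℝ)..τ, tail f (Real.exp (τ - s) * m) =
      ∫ x in m..Real.exp τ * m, tail f x / x := by
  rw [intervalIntegral.integral_comp_sub_left (fun u => tail f (Real.exp u * m)) τ, sub_self,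
    sub_zero]
  have hpos : ∀ u : ℝ, 0 < Real.exp u * m := fun u => by positivity
  have hsubst := intervalIntegral.integral_comp_mul_deriv' (a := 0) (b := τ)
    (f := fun u => Real.exp u * m) (f' := fun u => Real.exp u * m) (g := fun x => tail f x / x)
    (fun u _ => (Real.hasDerivAt_exp u).mul_const m) (by fun_prop) (by
      refine (continuous_tail hf).continuousOn.div continuousOn_id ?_
      rintro _ ⟨u, _, rfl⟩
      exact (hpos u).ne')
  simp only [Function.comp_apply, Real.exp_zero, one_mul] at hsubst
  rw [← hsubst]
  exact intervalIntegral.integral_congr fun u _ => (div_mul_cancel₀ _ (hpos u).ne').symm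

theorem tail_rescaleL1_add_integral (f h : L1) (β τ a : ℝ) :
    tail (rescaleL1 τ f + ∫ s in (0 : ℝ)..τ, β • rescaleL1 (τ - s) h : L1) a =
      tail f (Real.exp τ * max a 1) +
        β * ∫ x in max a 1..Real.exp τ * max a 1, tail h x / x := by
  have hc : Continuous fun s => β • rescaleL1 (τ - s) h :=
    ((continuous_rescaleL1_left h).comp (by fun_prop)).const_smul β
  rw [← tailCLM_apply, map_add, ← ContinuousLinearMap.intervalIntegral_comp_comm _
    (hc.intervalIntegrable _ _), tailCLM_apply, tail_rescaleL1,
    ← integral_tail_exp_mul (L1.integrable_coeFn h) (by positivity),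
    ← intervalIntegral.integral_const_mul]
  simp only [map_smul, tailCLM_apply, tail_rescaleL1, smul_eq_mul]

theorem coeFn_shiftL1_nonlinL1 (N : ℕ) (p : ℕ → ℝ) (f : L1) :
    shiftL1 (nonlinL1 N p f) =ᵐ[volume] shift (nonlin N p f) :=
  (Integrable.coeFn_toL1 _).trans (shift_congr (Integrable.coeFn_toL1 _))

/-- The constant function `τ ↦ f` satisfies the Duhamel formula of the evolution equation with
constant trace `β`. -/
def StationaryDuhamel (N : ℕ) (p : ℕ → ℝ) (β : ℝ) (f : L1) : Prop :=
  ∀ τ, 0 ≤ τ → f = rescaleL1 τ f +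
    ∫ s in (0 : ℝ)..τ, β • rescaleL1 (τ - s) (shiftL1 (nonlinL1 N p f))

theorem SteadyRelation.stationaryDuhamel {β : ℝ} {f : L1} (h : SteadyRelation N p β f)
    (hf : SupportedFromOne f) : StationaryDuhamel N p β f := by
  intro τ hτ
  have hi := L1.integrable_coeFn f
  refine eq_of_tail_eq (funext fun a => ?_)
  rw [tail_rescaleL1_add_integral, ← tail_max_one hi hf a,
    tail_congr (coeFn_shiftL1_nonlinL1 N p f), ← sub_eq_iff_eq_add', tail_sub_tail hi,
    ← intervalIntegral.integral_const_mul]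
  refine intervalIntegral.integral_congr_ae ?_
  filter_upwards [h] with x hx hmem
  rw [uIoc_of_le (le_mul_of_one_le_left (by positivity) (Real.one_le_exp hτ))] at hmem
  have h1 : 1 < x := (le_max_right a 1).trans_lt hmem.1
  rw [← mul_div_assoc, ← hx h1, mul_div_cancel_left₀ _ (by positivity)]

theorem StationaryDuhamel.steadyRelation {β : ℝ} {f : L1} (h : StationaryDuhamel N p β f) :
    SteadyRelation N p β f := by
  have hi := L1.integrable_coeFn f
  have hk := integrable_shift (integrable_nonlin N p hi)
  set k := shift (nonlin N p f)
  have htail : ∀ y, 1 < y → tail f y = tail f 1 - β * ∫ x in (1 : ℝ)..y, tail k x / x := by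
    intro y hy
    have hy1 := congrArg (fun g : L1 => tail g 1) (h (Real.log y) (Real.log_nonneg hy.le))
    simp only [tail_rescaleL1_add_integral, max_self, mul_one,
      Real.exp_log (zero_lt_one.trans hy), tail_congr (coeFn_shiftL1_nonlinL1 N p f)] at hy1
    exact eq_sub_of_add_eq hy1.symm
  have hcont : ContinuousOn (fun x => tail k x / x) (Ioi 0) :=
    (continuous_tail hk).continuousOn.div continuousOn_id fun x hx => (mem_Ioi.1 hx).ne'
  filter_upwards [ae_hasDerivAt_tail hi] with y hy h1
  have hy0 : 0 < y := zero_lt_one.trans h1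
  have hint : HasDerivAt (fun y => ∫ x in (1 : ℝ)..y, tail k x / x) (tail k y / y) y := by
    refine intervalIntegral.integral_hasDerivAt_right (hcont.mono ?_).intervalIntegrable
      (hcont.stronglyMeasurableAtFilter isOpen_Ioi y hy0) (hcont.continuousAt (Ioi_mem_nhds hy0))
    rw [uIcc_of_le h1.le]
    exact fun x hx => zero_lt_one.trans_le hx.1
  have hderiv : -f y = -(β * (tail k y / y)) := by
    refine hy.unique (((hint.const_mul β).const_sub (tail f 1)).congr_of_eventuallyEq ?_)
    filter_upwards [lt_mem_nhds h1] with z hz using htail z hz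
  rw [neg_injective hderiv]
  field

theorem SteadyRelation.mul_eq {β : ℝ} (h : SteadyRelation N p β f)
    (hp_sum : ∑ j ∈ Finset.Icc 1 N, p j = 1) (hf : IsDensity f) :
    ∀ᵐ y : ℝ, y ∈ Icc (1 : ℝ) 2 → y * f y = β := by
  filter_upwards [h, Measure.ae_ne volume (1 : ℝ)] with y hy hy1 hmem
  rw [hy (lt_of_le_of_ne hmem.1 hy1.symm), hf.tail_shift_nonlin_of_le_two hp_sum hmem.2, mul_one]

theorem SteadyRelation.hasValueAtOne {β : ℝ} {f : L1} (h : SteadyRelation N p β f)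
    (hp_sum : ∑ j ∈ Finset.Icc 1 N, p j = 1) (hf : IsDensity f) : HasValueAtOne f β := by
  refine ⟨fun y => β / y, continuousOn_const.div continuousOn_id fun x hx => ?_, by simp, ?_⟩
  · exact (zero_lt_one.trans_le hx.1).ne'
  · filter_upwards [h.mul_eq hp_sum hf] with y hy hmem
    rw [← hy hmem, mul_div_cancel_left₀ _ (zero_lt_one.trans_le hmem.1).ne']

theorem ae_comp_exp_sub {P : ℝ → Prop} (h : ∀ᵐ y : ℝ, P y) (τ₀ : ℝ) :
    ∀ᵐ τ : ℝ, P (Real.exp (τ - τ₀)) := by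
  have hexp : ∀ᵐ t : ℝ, P (Real.exp t) := by
    rw [ae_iff] at h ⊢
    have himage := addHaar_image_eq_zero_of_differentiableOn_of_addHaar_eq_zero volume
      (f := Real.log) (s := {y | ¬ P y} ∩ Ioi 0)
      (fun x hx => (Real.differentiableAt_log (mem_Ioi.1 hx.2).ne').differentiableWithinAt)
      (measure_mono_null inter_subset_left h)
    refine measure_mono_null (fun t ht => ?_) himage
    exact ⟨Real.exp t, ⟨ht, Real.exp_pos t⟩, Real.log_exp t⟩
  exact (measurePreserving_sub_right volume τ₀).quasiMeasurePreserving.tendsto_ae.eventually hexp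

theorem exp_sub_mem_Icc {τ τ₀ : ℝ} (h : τ ∈ Icc τ₀ (τ₀ + Real.log 2)) :
    Real.exp (τ - τ₀) ∈ Icc (1 : ℝ) 2 := by
  refine ⟨Real.one_le_exp (by linarith [h.1]), ?_⟩
  rw [← Real.le_log_iff_exp_le two_pos]
  linarith [h.2]

theorem SteadyRelation.trace_eq {β : ℝ} (h : SteadyRelation N p β f)
    (hp_sum : ∑ j ∈ Finset.Icc 1 N, p j = 1) (hf : IsDensity f) (τ₀ : ℝ) :
    ∀ᵐ τ : ℝ, τ ∈ Icc τ₀ (τ₀ + Real.log 2) →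
      Real.exp (τ - τ₀) * f (Real.exp (τ - τ₀)) = β := by
  filter_upwards [ae_comp_exp_sub (h.mul_eq hp_sum hf) τ₀] with τ hτ hmem
  exact hτ (exp_sub_mem_Icc hmem)

theorem SteadyRelation.isGlobalSolution {β : ℝ} {f : L1} (h : SteadyRelation N p β f)
    (hp_sum : ∑ j ∈ Finset.Icc 1 N, p j = 1) (hf : IsDensity f) :
    IsGlobalSolution N p f fun _ => f := by
  refine ⟨continuousOn_const, fun _ _ => hf.eq_zero, fun _ => β,
    (locallyIntegrable_const β).locallyIntegrableOn _, fun τ₀ _ => ?_,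
    h.stationaryDuhamel hf.eq_zero⟩
  filter_upwards [h.trace_eq hp_sum hf τ₀] with τ hτ hmem using (hτ hmem).symm

/-! ### Uniqueness of solutions with constant trace -/

theorem eq_zero_of_le_mul_integral {u : ℝ → ℝ} {K T : ℝ} (hc : ContinuousOn u (Icc 0 T))
    (h0 : ∀ t ∈ Icc 0 T, 0 ≤ u t)
    (h : ∀ t ∈ Icc 0 T, u t ≤ K * ∫ s in (0 : ℝ)..t, u s) : ∀ t ∈ Icc 0 T, u t = 0 := by
  rcases lt_or_ge T 0 with hT | hT
  · simp [Icc_eq_empty_of_lt hT]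
  set v := IccExtend hT ((Icc 0 T).domRestrict u)
  have hv : Continuous v := hc.domRestrict.Icc_extend'
  have hvu : ∀ t ∈ Icc 0 T, v t = u t := fun t ht => IccExtend_of_mem hT _ ht
  have hint : ∀ t ∈ Icc 0 T, ∫ s in (0 : ℝ)..t, u s = ∫ s in (0 : ℝ)..t, v s := fun t ht => by
    refine intervalIntegral.integral_congr fun s hs => (hvu s ?_).symm
    rw [uIcc_of_le ht.1] at hs
    exact ⟨hs.1, hs.2.trans ht.2⟩
  have hder : ∀ t, HasDerivAt (fun t => ∫ s in (0 : ℝ)..t, v s) (v t) t := fun t =>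
    (hv.integral_hasStrictDerivAt 0 t).hasDerivAt
  have hzero := eq_zero_of_abs_deriv_le_mul_abs_self_of_eq_zero_right (K := K)
    (f := fun t => ∫ s in (0 : ℝ)..t, v s) (f' := v) (a := 0) (b := T)
    (fun t _ => (hder t).continuousAt.continuousWithinAt)
    (fun t _ => (hder t).hasDerivWithinAt) (by simp) fun t ht => by
      have ht' := Ico_subset_Icc_self ht
      have hnonneg : 0 ≤ ∫ s in (0 : ℝ)..t, u s :=
        intervalIntegral.integral_nonneg ht.1 fun s hs => h0 s ⟨hs.1, hs.2.trans ht'.2⟩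
      rw [hvu t ht', Real.norm_of_nonneg (h0 t ht'), ← hint t ht', Real.norm_of_nonneg hnonneg]
      exact h t ht'
  intro t ht
  refine le_antisymm ((h t ht).trans ?_) (h0 t ht)
  rw [hint t ht, hzero t ht, mul_zero]

theorem norm_integral_rescaleL1_sub_le {A : Set L1} {K : NNReal}
    (hK : LipschitzOnWith K (nonlinL1 N p) A) {η ζ : ℝ → L1} {t : ℝ} (ht : 0 ≤ t)
    (hη : ContinuousOn η (Icc 0 t)) (hζ : ContinuousOn ζ (Icc 0 t))
    (hηA : MapsTo η (Icc 0 t) A) (hζA : MapsTo ζ (Icc 0 t) A) (β : ℝ) :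
    ‖(∫ s in (0 : ℝ)..t, β • rescaleL1 (t - s) (shiftL1 (nonlinL1 N p (η s)))) -
        ∫ s in (0 : ℝ)..t, β • rescaleL1 (t - s) (shiftL1 (nonlinL1 N p (ζ s)))‖ ≤
      |β| * K * ∫ s in (0 : ℝ)..t, ‖η s - ζ s‖ := by
  rw [← uIcc_of_le ht] at hη hζ
  have hint : ∀ {θ : ℝ → L1}, ContinuousOn θ [[0, t]] → IntervalIntegrable
      (fun s => β • rescaleL1 (t - s) (shiftL1 (nonlinL1 N p (θ s)))) volume 0 t := fun hθ =>
    ((continuousOn_rescaleL1_shiftL1_nonlinL1 N p hθ t).const_smul β).intervalIntegrable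
  rw [← intervalIntegral.integral_sub (hint hη) (hint hζ), ← intervalIntegral.integral_const_mul]
  refine intervalIntegral.norm_integral_le_of_norm_le ht (.of_forall fun s hs => ?_)
    (continuousOn_const.mul (hη.sub hζ).norm).intervalIntegrable
  have hs' := Ioc_subset_Icc_self hs
  rw [← smul_sub, norm_smul, Real.norm_eq_abs, mul_assoc]
  refine mul_le_mul_of_nonneg_left ?_ (abs_nonneg β)
  exact ((norm_rescaleL1_sub_le _ _ _).trans (norm_shiftL1_sub_le _ _)).trans
    (hK.norm_sub_le (hηA hs') (hζA hs'))

theorem StationaryDuhamel.eq_of_ae_trace_eq {f : L1} {β T : ℝ} {η : ℝ → L1} {b : ℝ → ℝ}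
    (hf : StationaryDuhamel N p β f) (hη : ContinuousOn η (Icc 0 T))
    (h : ∀ τ, 0 ≤ τ → η τ = rescaleL1 τ f +
      ∫ s in (0 : ℝ)..τ, b s • rescaleL1 (τ - s) (shiftL1 (nonlinL1 N p (η s))))
    (hb : ∀ᵐ s : ℝ, s ∈ Icc 0 T → b s = β) : ∀ τ ∈ Icc 0 T, η τ = f := by
  obtain ⟨K, hK⟩ := (contDiff_nonlinL1 N p).locallyLipschitz.locallyLipschitzOn
    |>.exists_lipschitzOnWith_of_compact ((isCompact_Icc.image_of_continuousOn hη).insert f)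
  have hzero : ∀ τ ∈ Icc 0 T, ‖η τ - f‖ = 0 := by
    refine eq_zero_of_le_mul_integral (K := |β| * K) (hη.sub continuousOn_const).norm
      (fun _ _ => norm_nonneg _) fun t ht => ?_
    have hsub : Icc 0 t ⊆ Icc 0 T := Icc_subset_Icc_right ht.2
    have htrace : ∫ s in (0 : ℝ)..t, b s • rescaleL1 (t - s) (shiftL1 (nonlinL1 N p (η s))) =
        ∫ s in (0 : ℝ)..t, β • rescaleL1 (t - s) (shiftL1 (nonlinL1 N p (η s))) := by
      refine intervalIntegral.integral_congr_ae ?_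
      filter_upwards [hb] with s hs hmem
      rw [uIoc_of_le ht.1] at hmem
      rw [hs (hsub (Ioc_subset_Icc_self hmem))]
    have hdiff : η t - f = (∫ s in (0 : ℝ)..t,
          β • rescaleL1 (t - s) (shiftL1 (nonlinL1 N p (η s)))) -
        ∫ s in (0 : ℝ)..t, β • rescaleL1 (t - s) (shiftL1 (nonlinL1 N p f)) := by
      have hηt := h t ht.1
      rw [htrace] at hηt
      exact (congrArg₂ (· - ·) hηt (hf t ht.1)).trans (add_sub_add_left_eq_sub _ _ _)
    simp only [hdiff]
    exact norm_integral_rescaleL1_sub_le hK ht.1 (hη.mono hsub) continuousOn_const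
      (fun s hs => mem_insert_of_mem f (mem_image_of_mem η (hsub hs)))
      (fun _ _ => mem_insert f _) β
  exact fun τ hτ => sub_eq_zero.1 (norm_eq_zero.1 (hzero τ hτ))

theorem ae_nonneg_of_ae_Icc_nat_mul {P : ℝ → Prop} {L : ℝ} (hL : 0 < L)
    (h : ∀ n : ℕ, (∀ᵐ τ : ℝ, τ ∈ Icc 0 (n * L) → P τ) →
      ∀ᵐ τ : ℝ, τ ∈ Icc (n * L) (n * L + L) → P τ) :
    ∀ᵐ τ : ℝ, 0 ≤ τ → P τ := by
  have hn : ∀ n : ℕ, ∀ᵐ τ : ℝ, τ ∈ Icc 0 (n * L) → P τ := by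
    intro n
    induction n with
    | zero =>
      filter_upwards [Measure.ae_ne volume (0 : ℝ)] with τ hτ hmem
      exact absurd (by simpa using hmem) hτ
    | succ n ih =>
      filter_upwards [ih, h n ih] with τ hτ hτ' hmem
      rw [Nat.cast_succ, add_one_mul] at hmem
      exact (le_total τ (n * L)).elim (fun hle => hτ ⟨hmem.1, hle⟩) fun hle => hτ' ⟨hle, hmem.2⟩
  filter_upwards [ae_all_iff.2 hn] with τ hτ h0
  obtain ⟨n, hτn⟩ := exists_nat_ge (τ / L)
  exact hτ n ⟨h0, (div_le_iff₀ hL).1 hτn⟩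

theorem SteadyRelation.isSteadyState {β : ℝ} {f : L1} (h : SteadyRelation N p β f)
    (hp_sum : ∑ j ∈ Finset.Icc 1 N, p j = 1) (hf : IsDensity f) : IsSteadyState N p f := by
  refine ⟨⟨_, h.isGlobalSolution hp_sum hf⟩, ?_⟩
  rintro η ⟨hη, -, b, -, htrace, hduhamel⟩
  have hunique : ∀ T, (∀ᵐ τ : ℝ, τ ∈ Icc 0 T → b τ = β) → ∀ τ ∈ Icc 0 T, η τ = f := fun T hb =>
    (h.stationaryDuhamel hf.eq_zero).eq_of_ae_trace_eq (hη.mono Icc_subset_Ici_self) hduhamel hb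
  have hb : ∀ᵐ τ : ℝ, 0 ≤ τ → b τ = β := by
    refine ae_nonneg_of_ae_Icc_nat_mul (Real.log_pos one_lt_two) fun n hn => ?_
    have hn0 : 0 ≤ n * Real.log 2 := by positivity
    filter_upwards [htrace _ hn0, h.trace_eq hp_sum hf (n * Real.log 2)] with τ hτ hτ' hmem
    rw [hτ hmem, hunique _ hn _ ⟨hn0, le_rfl⟩, hτ' hmem]
  exact fun τ hτ => hunique τ (hb.mono fun s hs hmem => hs hmem.1) τ ⟨hτ, le_rfl⟩

/-! ### The trace of a stationary solution -/

theorem eq_of_ae_eq_comp_sub {E : Type*} [TopologicalSpace E] [T2Space E] {b G : ℝ → E} {L : ℝ}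
    (hG : ContinuousOn G (Icc 0 L))
    (hb : ∀ τ₀, 0 ≤ τ₀ → ∀ᵐ τ : ℝ, τ ∈ Icc τ₀ (τ₀ + L) → b τ = G (τ - τ₀)) :
    ∀ δ ∈ Ico 0 L, G δ = G 0 := by
  intro δ hδ
  have hae : G =ᵐ[volume.restrict (Icc δ L)] fun t => G (t - δ) := by
    refine (ae_restrict_iff' measurableSet_Icc).2 ?_
    filter_upwards [hb 0 le_rfl, hb δ hδ.1] with t ht ht' hmem
    rw [← ht' ⟨hmem.1, by linarith [hmem.2, hδ.1]⟩,
      ht ⟨hδ.1.trans hmem.1, by linarith [hmem.2]⟩, sub_zero]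
  have heq := Measure.eqOn_Icc_of_ae_eq volume hδ.2.ne hae (hG.mono (Icc_subset_Icc_left hδ.1))
    (hG.comp (by fun_prop) fun t ht => ⟨by linarith [ht.1], by linarith [ht.2, hδ.1]⟩)
    (left_mem_Icc.2 hδ.2.le)
  exact heq.trans (congrArg G (sub_self δ))

theorem HasValueAtOne.ae_trace_eq {f : L1} {β : ℝ} (hβ : HasValueAtOne f β) {b : ℝ → ℝ}
    (hb : ∀ τ₀, 0 ≤ τ₀ → ∀ᵐ τ : ℝ, τ ∈ Icc τ₀ (τ₀ + Real.log 2) →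
      b τ = Real.exp (τ - τ₀) * f (Real.exp (τ - τ₀))) :
    ∀ᵐ τ : ℝ, 0 ≤ τ → b τ = β := by
  obtain ⟨g, hg, hg1, hfg⟩ := hβ
  let G : ℝ → ℝ := fun t => Real.exp t * g (Real.exp t)
  have hG : ContinuousOn G (Icc 0 (Real.log 2)) := by
    refine Real.continuous_exp.continuousOn.mul
      (hg.comp Real.continuous_exp.continuousOn fun t ht => ?_)
    simpa using exp_sub_mem_Icc (τ := t) (τ₀ := 0) (by simpa using ht)
  have hbG : ∀ τ₀, 0 ≤ τ₀ → ∀ᵐ τ : ℝ, τ ∈ Icc τ₀ (τ₀ + Real.log 2) → b τ = G (τ - τ₀) := by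
    intro τ₀ h0
    filter_upwards [hb τ₀ h0, ae_comp_exp_sub hfg τ₀] with τ hτ hτ' hmem
    rw [hτ hmem, hτ' (exp_sub_mem_Icc hmem)]
  have hG0 : G 0 = β := by simp [G, hg1]
  refine ae_nonneg_of_ae_Icc_nat_mul (Real.log_pos one_lt_two) fun n _ => ?_
  filter_upwards [hbG (n * Real.log 2) (by positivity),
    Measure.ae_ne volume (n * Real.log 2 + Real.log 2)] with τ hτ hne hmem
  rw [hτ hmem, eq_of_ae_eq_comp_sub hG hbG _
    ⟨by linarith [hmem.1], by linarith [lt_of_le_of_ne hmem.2 hne]⟩, hG0]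

theorem IsSteadyState.stationaryDuhamel {f : L1} {β : ℝ} (h : IsSteadyState N p f)
    (hβ : HasValueAtOne f β) : StationaryDuhamel N p β f := by
  obtain ⟨⟨η, hη⟩, hunique⟩ := h
  have hconst := hunique η hη
  obtain ⟨-, -, b, -, htrace, hduhamel⟩ := hη
  have hb : ∀ᵐ τ : ℝ, 0 ≤ τ → b τ = β :=
    hβ.ae_trace_eq fun τ₀ h0 => by simpa only [hconst τ₀ h0] using htrace τ₀ h0
  intro τ hτ
  have hτf := hduhamel τ hτ
  rw [hconst τ hτ] at hτf
  refine hτf.trans (congrArg _ (intervalIntegral.integral_congr_ae ?_))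
  filter_upwards [hb] with s hs hmem
  rw [uIoc_of_le hτ] at hmem
  rw [hs hmem.1.le, hconst s hmem.1.le]

end Coarsening

theorem proposition4p3 (N : ℕ) (p : ℕ → ℝ)
    (hp_nonneg : ∀ j ∈ Finset.Icc 1 N, 0 ≤ p j)
    (hp_sum : ∑ j ∈ Finset.Icc 1 N, p j = 1)
    (η₀ : Coarsening.L1) (hη₀ : η₀ ∈ Coarsening.probDensities)
    (β : ℝ) (hβ : 0 < β) :
    List.TFAE
      [Coarsening.IsSteadyState N p η₀ ∧ Coarsening.HasValueAtOne η₀ β,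
       ∃ η : ℝ → ℝ, Coarsening.SolvesSteadyODE N p β η ∧
         ∀ᵐ y : ℝ, 1 < y → η₀ y = η y,
       ∀ᵐ y : ℝ, Coarsening.calN N p η₀ y = β * Coarsening.wStar y] := by
  have hf := Coarsening.isDensity_of_mem_probDensities hη₀
  tfae_have 1 → 2 := fun ⟨hsteady, hvalue⟩ =>
    (hsteady.stationaryDuhamel hvalue).steadyRelation.exists_solvesSteadyODE hp_sum hf
  tfae_have 2 → 3 := fun ⟨_, hη, hη₀η⟩ =>
    ((hη.steadyRelation hp_sum hf hη₀η).isTransformOf hp_nonneg hp_sum hf).calN_ae_eq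
  tfae_have 3 → 1 := fun hcalN => by
    have hrelation := Coarsening.steadyRelation_of_calN_ae_eq hp_nonneg hp_sum hf hβ.ne' hcalN
    exact ⟨hrelation.isSteadyState hp_sum hf, hrelation.hasValueAtOne hp_sum hf⟩
  tfae_finish
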